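/- Let $N$ be a dimension, $\alpha\in(0,1)$, $d>0$, $a\ge 0$, $T>0$, and let $m\in\mathbb N$ with $m>N/2$. Let $H^m(\mathbb R^N)$ be the ($L^2$-based) Sobolev space of order $m$, let $H^{-m}(\mathbb R^N)$ be its dual with the dual norm, and let $L^\infty_\alpha([0,T],H^{-m}(\mathbb R^N))$ be the set of maps $v$ with $v(t)\in H^{-m}(\mathbb R^N)$ for all $t\in[0,T]$ and $\sup_{t\in[0,T]}t^\alpha\|v(t)\|_{H^{-m}(\mathbb R^N)}<+\infty$. A (distributional) solution on $[0,T]$ of $$\partial_t^\alpha u-d\,\Delta u=a\,u\quad\text{in }\mathbb R^N\times(0,\infty),\qquad u(\cdot,0)=\delta,$$ where $\partial_t^\alpha$ is the Caputo derivative and $\delta$ the Dirac delta at the origin, is a map $u\in L^\infty_\alpha([0,T],H^{-m}(\mathbb R^N))$ such that, for every $\varphi\in C_0^\infty(\mathbb R^N)$ and every $t\in[0,T]$, the function $\tau\mapsto (t-\tau)^{\alpha-1}\big(d\langle u(\tau),\Delta\varphi\rangle+a\langle u(\tau),\varphi\rangle\big)$ is integrable on $(0,t)$ and $$\langle u(t),\varphi\rangle=\varphi(0)+\frac1{\Gamma(\alpha)}\int_0^t\frac{d\langle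 u(\tau),\Delta\varphi\rangle+a\langle u(\tau),\varphi\rangle}{(t-\tau)^{1-\alpha}}\,d\tau .$$ Then there is exactly one such solution $u$. Moreover, for every $t\in[0,T]$, the function $\xi\mapsto E_\alpha\big((a-4\pi^2d|\xi|^2)t^\alpha\big)$ is essentially bounded on $\mathbb R^N$ and $$u(t)=\mathcal F^{-1}\Big(E_\alpha\big((a-4\pi^2d|\xi|^2)t^\alpha\big)\Big)$$ as tempered distributions, where $\mathcal F\phi(\xi)=\int_{\mathbb R^N}\phi(x)e^{-2\pi i x\cdot\xi}\,dx$ is the Fourier transform and $E_\alpha(r)=\sum_{k=0}^\infty \frac{r^k}{\Gamma(1+k\alpha)}$ is the Mittag-Leffler function. -/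

import Mathlib

open MeasureTheory FourierTransform Laplacian
open scoped SchwartzMap ENNReal

noncomputable section

namespace TimeFractional

/-- The Mittag-Leffler function `E_α(r) = ∑ r ^ k / Γ(1 + k α)`. -/
def mittagLeffler (α r : ℝ) : ℝ :=
  ∑' k : ℕ, r ^ k / Real.Gamma (1 + k * α)

/-- The tempered distributions on `ℝ ^ N` that lie in the Sobolev space `H ^ m = H ^ {m, 2}`,
as a linear subspace. -/
def sobolevSubmodule (N m : ℕ) : Submodule ℂ 𝓢'(EuclideanSpace ℝ (Fin N), ℂ) where
  carrier := {f | TemperedDistribution.MemSobolev (m : ℝ) 2 f}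
  add_mem' hf hg := hf.add hg
  zero_mem' := TemperedDistribution.memSobolev_fun_zero _ _ _ _
  smul_mem' c _ hf := hf.smul c

/-- The Sobolev space `H ^ m(ℝ ^ N)` of complex-valued functions. It is a type of its own, so that
it carries the norm below and not the topology of tempered distributions. -/
def Sobolev (N m : ℕ) : Type := sobolevSubmodule N m

namespace Sobolev

variable {N m : ℕ}

instance : AddCommGroup (Sobolev N m) := inferInstanceAs (AddCommGroup (sobolevSubmodule N m))

instance : Module ℂ (Sobolev N m) := inferInstanceAs (Module ℂ (sobolevSubmodule N m))

/-- A Sobolev function, seen as a tempered distribution. -/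
def toDistribution : Sobolev N m →ₗ[ℂ] 𝓢'(EuclideanSpace ℝ (Fin N), ℂ) :=
  (sobolevSubmodule N m).subtype

theorem memSobolev (f : Sobolev N m) :
    TemperedDistribution.MemSobolev (m : ℝ) 2 (toDistribution f) :=
  f.2

theorem lp_toTemperedDistribution_injective :
    Function.Injective
      (Lp.toTemperedDistributionCLM ℂ (volume : Measure (EuclideanSpace ℝ (Fin N))) 2) :=
  LinearMap.ker_eq_bot.mp Lp.ker_toTemperedDistributionCLM_eq_bot

/-- The `L ^ 2` function `𝓕⁻ ((1 + |ξ| ^ 2) ^ (m / 2) 𝓕 f)`, for `f` in `H ^ m`. -/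
def besselFun (f : Sobolev N m) : Lp ℂ 2 (volume : Measure (EuclideanSpace ℝ (Fin N))) :=
  (memSobolev f).choose

theorem besselFun_spec (f : Sobolev N m) :
    TemperedDistribution.besselPotential (EuclideanSpace ℝ (Fin N)) ℂ (m : ℝ) (toDistribution f) =
      Lp.toTemperedDistributionCLM ℂ volume 2 (besselFun f) :=
  (memSobolev f).choose_spec

/-- The linear map `f ↦ 𝓕⁻ ((1 + |ξ| ^ 2) ^ (m / 2) 𝓕 f)` from `H ^ m` to `L ^ 2`. -/
def bessel : Sobolev N m →ₗ[ℂ] Lp ℂ 2 (volume : Measure (EuclideanSpace ℝ (Fin N))) where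
  toFun := besselFun
  map_add' f g := by
    apply lp_toTemperedDistribution_injective
    rw [map_add, ← besselFun_spec, ← besselFun_spec, ← besselFun_spec, map_add, map_add]
  map_smul' c f := by
    apply lp_toTemperedDistribution_injective
    rw [map_smul, ← besselFun_spec, ← besselFun_spec, map_smul, map_smul, RingHom.id_apply]

theorem bessel_spec (f : Sobolev N m) :
    TemperedDistribution.besselPotential (EuclideanSpace ℝ (Fin N)) ℂ (m : ℝ) (toDistribution f) =
      (bessel f : 𝓢'(EuclideanSpace ℝ (Fin N), ℂ)) :=
  besselFun_spec f

theorem bessel_injective : Function.Injective (bessel (N := N) (m := m)) := by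
  intro f g h
  have h1 : TemperedDistribution.besselPotential (EuclideanSpace ℝ (Fin N)) ℂ (m : ℝ)
      (toDistribution f) = TemperedDistribution.besselPotential (EuclideanSpace ℝ (Fin N)) ℂ
      (m : ℝ) (toDistribution g) := by
    rw [bessel_spec, bessel_spec, h]
  have h2 := (TemperedDistribution.besselPotential_neg_apply_eq_iff (m : ℝ) _ _).mpr h1
  rw [(TemperedDistribution.besselPotential_neg_apply_eq_iff (m : ℝ) _ _).mpr rfl] at h2
  exact Subtype.ext h2.symm

/-- The norm of `H ^ m` is the `L ^ 2` norm of `𝓕⁻ ((1 + |ξ| ^ 2) ^ (m / 2) 𝓕 f)`. -/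
instance : NormedAddCommGroup (Sobolev N m) :=
  NormedAddCommGroup.induced (Sobolev N m) (Lp ℂ 2 (volume : Measure (EuclideanSpace ℝ (Fin N))))
    bessel bessel_injective

instance : NormedSpace ℂ (Sobolev N m) :=
  NormedSpace.induced ℂ (Sobolev N m) (Lp ℂ 2 (volume : Measure (EuclideanSpace ℝ (Fin N)))) bessel

theorem norm_eq (f : Sobolev N m) : ‖f‖ = ‖bessel f‖ := rfl

theorem isometry_bessel : Isometry (bessel (N := N) (m := m)) :=
  AddMonoidHomClass.isometry_of_norm bessel fun f ↦ (norm_eq f).symm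

/-- A Schwartz function, seen as an element of `H ^ m`. -/
def ofSchwartzₗ : 𝓢(EuclideanSpace ℝ (Fin N), ℂ) →ₗ[ℂ] Sobolev N m where
  toFun φ := ⟨(φ : 𝓢'(EuclideanSpace ℝ (Fin N), ℂ)), φ.memSobolev⟩
  map_add' φ ψ := Subtype.ext (map_add _ φ ψ)
  map_smul' c φ := Subtype.ext (map_smul _ c φ)

theorem bessel_ofSchwartz (φ : 𝓢(EuclideanSpace ℝ (Fin N), ℂ)) :
    bessel (ofSchwartzₗ (m := m) φ) =
      SchwartzMap.toLpCLM ℂ ℂ 2 volume (SchwartzMap.fourierMultiplierCLM ℂ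
        (fun x : EuclideanSpace ℝ (Fin N) ↦ ((1 + ‖x‖ ^ 2) ^ ((m : ℝ) / 2) : ℝ)) φ) := by
  apply lp_toTemperedDistribution_injective
  simp only [Lp.toTemperedDistributionCLM_apply]
  rw [← bessel_spec]
  change TemperedDistribution.besselPotential _ ℂ (m : ℝ)
    (φ : 𝓢'(EuclideanSpace ℝ (Fin N), ℂ)) = _
  rw [TemperedDistribution.besselPotential, SchwartzMap.toLpCLM_apply,
    Lp.toTemperedDistribution_toLp_eq,
    TemperedDistribution.fourierMultiplierCLM_toTemperedDistributionCLM_eq (by fun_prop)]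
  congr 1
  apply SchwartzMap.fourierMultiplierCLM_ofReal ℂ
    (Function.hasTemperateGrowth_one_add_norm_sq_rpow _ ((m : ℝ) / 2))

/-- The continuous embedding of the Schwartz space into `H ^ m`. -/
def ofSchwartz : 𝓢(EuclideanSpace ℝ (Fin N), ℂ) →L[ℂ] Sobolev N m where
  toLinearMap := ofSchwartzₗ
  cont := by
    refine isometry_bessel.isUniformInducing.isInducing.continuous_iff.mpr ?_
    have h : (bessel ∘ ofSchwartzₗ : 𝓢(EuclideanSpace ℝ (Fin N), ℂ) → _) = _ :=
      funext (bessel_ofSchwartz (m := m))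
    exact h ▸ (ContinuousLinearMap.continuous _).comp (ContinuousLinearMap.continuous _)

end Sobolev

/-- `H ^ {-m}(ℝ ^ N)`: the dual of `H ^ m(ℝ ^ N)`, with the dual (operator) norm. -/
abbrev NegSobolev (N m : ℕ) : Type := Sobolev N m →L[ℂ] ℂ

/-- An element of `H ^ {-m}`, seen as a tempered distribution. -/
def NegSobolev.toDistribution {N m : ℕ} (v : NegSobolev N m) :
    𝓢'(EuclideanSpace ℝ (Fin N), ℂ) :=
  ContinuousLinearMap.toPointwiseConvergenceCLM _ _ _ _ (v ∘L Sobolev.ofSchwartz)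

/-- Membership in `L^∞_α([0, T], H ^ {-m})`: the function `t ↦ t ^ α ‖v(t)‖` is bounded
on `[0, T]`. -/
def MemLinfWeighted {N m : ℕ} (α T : ℝ) (v : ℝ → NegSobolev N m) : Prop :=
  BddAbove ((fun t : ℝ ↦ t ^ α * ‖v t‖) '' Set.Icc 0 T)

/-- Distributional solutions on `[0, T]` of `∂_t^α u - d Δ u = a u`, `u(0) = δ`: elements of
`L^∞_α([0, T], H ^ {-m})` which satisfy, against every smooth compactly supported `φ`, the
associated Volterra integral equation on `[0, T]` (the integral being a convergent one).
Only the values of `u` on `[0, T]` matter. -/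
structure IsSolution {N m : ℕ} (α d a T : ℝ) (u : ℝ → NegSobolev N m) : Prop where
  memLinfWeighted : MemLinfWeighted α T u
  integrable : ∀ φ : 𝓢(EuclideanSpace ℝ (Fin N), ℂ), HasCompactSupport φ →
    ∀ t ∈ Set.Icc 0 T, IntervalIntegrable
      (fun τ : ℝ ↦ (d * u τ (Sobolev.ofSchwartz (Δ φ)) + a * u τ (Sobolev.ofSchwartz φ)) /
        (((t - τ) ^ (1 - α) : ℝ) : ℂ)) volume 0 t
  equation : ∀ φ : 𝓢(EuclideanSpace ℝ (Fin N), ℂ), HasCompactSupport φ →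
    ∀ t ∈ Set.Icc 0 T, u t (Sobolev.ofSchwartz φ) =
      φ 0 + 1 / (Real.Gamma α : ℂ) * ∫ τ in (0 : ℝ)..t,
        (d * u τ (Sobolev.ofSchwartz (Δ φ)) + a * u τ (Sobolev.ofSchwartz φ)) /
          (((t - τ) ^ (1 - α) : ℝ) : ℂ)

/-- The function `ξ ↦ E_α((a - 4 π² d |ξ|²) t ^ α)` on `ℝ ^ N`. -/
def symbol (N : ℕ) (α d a t : ℝ) (ξ : EuclideanSpace ℝ (Fin N)) : ℂ :=
  (mittagLeffler α ((a - 4 * Real.pi ^ 2 * d * ‖ξ‖ ^ 2) * t ^ α) : ℝ)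

end TimeFractional

end

/-! On the Fourier side the equation decouples: for each frequency `ξ` it is the scalar Volterra
equation `y(t) = 1 + (l / Γ(α)) ∫₀ᵗ (t - τ)^(α-1) y(τ) dτ` with `l = a - 4π²d|ξ|²`, solved by `E_α(l
t^α)` (`mittagLeffler_volterra`).

Existence. The symbol must be bounded uniformly in `ξ`. Since `l → -∞`, this rests on `0 ≤ E_α ≤ 1`
on the negative half-line. Nonnegativity (`mittagLeffler_neg_rpow_nonneg`) comes from a
first-crossing argument, which uses that the kernel decreases in `t` and that the zeros of `E_α` are
isolated; the upper bound then follows from the Volterra equation. For `m > N/2` a bounded symbol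
pairs continuously with `H^m`, because `(1 + |ξ|²)^(-m/2)` is in `L²`
(`NegSobolev.exists_of_bounded_symbol`). Fubini's theorem turns the scalar equations into the weak
one (`isSolution_of_symbol`).

Uniqueness. The difference `w` of two solutions satisfies the equation without the datum, first for
compactly supported test functions and then, by density, for all Schwartz ones. On test functions
with compactly supported Fourier transform, `dΔ + a` acts as a bounded operator with some constant
`C`. Iterating the equation from `‖w(t)‖ ≤ M t^(-α)` bounds `w` by a multiple of the `n`-th term of
the series of `E_α(C t^α)` (`norm_apply_le_of_volterraEq`), which tends to `0`. Such test functions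
are dense, hence `w = 0`. -/

namespace TimeFractional

open Filter Topology Set

/-! ### The Mittag-Leffler function: convergence, Volterra equation, bounds. -/

/-- Log-convexity of `Γ` between `p = y + α` and `p + 1`: the point `1 + y` is `α p + (1 - α)(p +
1)`, so `Γ(1 + y) ≤ p^(1-α) Γ(p)`. It controls the ratio of consecutive Mittag-Leffler coefficients.
-/
theorem rpow_mul_Gamma_le {α y : ℝ} (hα₀ : 0 < α) (hα₁ : α < 1) (hy : 0 ≤ y) :
    (y + α) ^ α * Real.Gamma (1 + y) ≤ Real.Gamma (1 + (y + α)) := by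
  have hp : 0 < y + α := by linarith
  have hG : 0 < Real.Gamma (y + α) := Real.Gamma_pos_of_pos hp
  have h1 : Real.Gamma (1 + (y + α)) = (y + α) * Real.Gamma (y + α) := by
    rw [add_comm, Real.Gamma_add_one hp.ne']
  have h := Real.Gamma_mul_add_mul_le_rpow_Gamma_mul_rpow_Gamma (s := y + α) (t := 1 + (y + α))
    (a := α) (b := 1 - α) hp (by linarith) hα₀ (by linarith) (by ring)
  rw [show α * (y + α) + (1 - α) * (1 + (y + α)) = 1 + y by ring, h1,
    Real.mul_rpow hp.le hG.le] at h
  rw [h1]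
  calc (y + α) ^ α * Real.Gamma (1 + y)
      ≤ (y + α) ^ α * (Real.Gamma (y + α) ^ α *
        ((y + α) ^ (1 - α) * Real.Gamma (y + α) ^ (1 - α))) := by gcongr
    _ = ((y + α) ^ α * (y + α) ^ (1 - α)) *
        (Real.Gamma (y + α) ^ α * Real.Gamma (y + α) ^ (1 - α)) := by ring
    _ = _ := by
      rw [← Real.rpow_add hp, ← Real.rpow_add hG, add_sub_cancel, Real.rpow_one, Real.rpow_one]

theorem Gamma_one_add_mul_pos {α : ℝ} (hα₀ : 0 < α) (k : ℕ) : 0 < Real.Gamma (1 + k * α) :=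
  Real.Gamma_pos_of_pos (by positivity)

theorem summable_mittagLeffler {α : ℝ} (hα₀ : 0 < α) (hα₁ : α < 1) (r : ℝ) :
    Summable fun k : ℕ ↦ r ^ k / Real.Gamma (1 + k * α) := by
  -- The ratio test below needs nonzero terms.
  rcases eq_or_ne r 0 with rfl | hr
  · exact summable_of_ne_finset_zero (s := {0}) fun k hk ↦ by
      simp only [Finset.mem_singleton] at hk
      simp [hk]
  have hlim : Tendsto (fun k : ℕ ↦ |r| / (k * α + α) ^ α) atTop (𝓝 0) := by
    refine tendsto_const_nhds.div_atTop ((tendsto_rpow_atTop hα₀).comp ?_)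
    exact tendsto_atTop_add_const_right _ _
      (tendsto_natCast_atTop_atTop.atTop_mul_const hα₀)
  refine summable_of_ratio_test_tendsto_lt_one zero_lt_one (Eventually.of_forall fun k ↦ ?_)
    (squeeze_zero (fun k ↦ by positivity) (fun k ↦ ?_) hlim)
  · exact div_ne_zero (pow_ne_zero _ hr) (Gamma_one_add_mul_pos hα₀ k).ne'
  · have hG := Gamma_one_add_mul_pos hα₀ k
    have hG' := Gamma_one_add_mul_pos hα₀ (k + 1)
    have h := rpow_mul_Gamma_le hα₀ hα₁ (y := k * α) (by positivity)
    rw [show (k : ℝ) * α + α = ((k + 1 : ℕ) : ℝ) * α by push_cast; ring] at h ⊢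
    have hp : 0 < (((k + 1 : ℕ) : ℝ) * α) ^ α := by positivity
    have hr' : 0 < |r| := abs_pos.mpr hr
    rw [norm_div, norm_div, norm_pow, norm_pow, Real.norm_eq_abs, Real.norm_of_nonneg hG.le,
      Real.norm_of_nonneg hG'.le, div_div_div_eq, div_le_div_iff₀ (by positivity) hp, pow_succ]
    calc |r| ^ k * |r| * Real.Gamma (1 + k * α) * (((k + 1 : ℕ) : ℝ) * α) ^ α
        = |r| ^ k * |r| * ((((k + 1 : ℕ) : ℝ) * α) ^ α * Real.Gamma (1 + k * α)) := by ring
      _ ≤ |r| ^ k * |r| * Real.Gamma (1 + ((k + 1 : ℕ) : ℝ) * α) := by gcongr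
      _ = _ := by ring

theorem hasSum_mittagLeffler {α : ℝ} (hα₀ : 0 < α) (hα₁ : α < 1) (r : ℝ) :
    HasSum (fun k : ℕ ↦ r ^ k / Real.Gamma (1 + k * α)) (mittagLeffler α r) :=
  (summable_mittagLeffler hα₀ hα₁ r).hasSum

theorem mittagLeffler_zero (α : ℝ) : mittagLeffler α 0 = 1 := by
  rw [mittagLeffler, tsum_eq_single 0 fun k hk ↦ by simp [hk]]
  simp

theorem analyticOnNhd_mittagLeffler {α : ℝ} (hα₀ : 0 < α) (hα₁ : α < 1) :
    AnalyticOnNhd ℝ (mittagLeffler α) univ := by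
  let c : ℕ → ℝ := fun k ↦ (Real.Gamma (1 + k * α))⁻¹
  have hc : FormalMultilinearSeries.ofScalarsSum (E := ℝ) c = mittagLeffler α := by
    rw [FormalMultilinearSeries.ofScalarsSum_eq_tsum]
    ext r
    simp [mittagLeffler, c, div_eq_inv_mul]
  have hr : (FormalMultilinearSeries.ofScalars ℝ c).radius = ⊤ := by
    refine FormalMultilinearSeries.radius_eq_top_of_summable_norm _ fun r ↦ ?_
    refine (summable_mittagLeffler hα₀ hα₁ r).congr fun k ↦ ?_
    rw [FormalMultilinearSeries.ofScalars_norm, norm_inv,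
      Real.norm_of_nonneg (Gamma_one_add_mul_pos hα₀ k).le, div_eq_inv_mul]
  have h := (FormalMultilinearSeries.ofScalars ℝ c).hasFPowerSeriesOnBall (by simp [hr])
  rw [hr] at h
  have h2 := h.analyticOnNhd
  have : (FormalMultilinearSeries.ofScalars ℝ c).sum = mittagLeffler α := hc
  rw [this] at h2
  simpa using h2

theorem continuous_mittagLeffler {α : ℝ} (hα₀ : 0 < α) (hα₁ : α < 1) :
    Continuous (mittagLeffler α) :=
  continuousOn_univ.mp (analyticOnNhd_mittagLeffler hα₀ hα₁).continuousOn

theorem mittagLeffler_nonneg_of_nonneg {α r : ℝ} (hα₀ : 0 < α) (hr : 0 ≤ r) :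
    0 ≤ mittagLeffler α r :=
  tsum_nonneg fun k ↦ div_nonneg (by positivity) (Gamma_one_add_mul_pos hα₀ k).le

theorem mittagLeffler_mono {α r s : ℝ} (hα₀ : 0 < α) (hα₁ : α < 1) (hr : 0 ≤ r) (hrs : r ≤ s) :
    mittagLeffler α r ≤ mittagLeffler α s :=
  (summable_mittagLeffler hα₀ hα₁ r).tsum_le_tsum (fun k ↦ by
    have := Gamma_one_add_mul_pos hα₀ k
    gcongr) (summable_mittagLeffler hα₀ hα₁ s)

/-- Each endpoint may carry a singularity; cutting at `t / 2` leaves one in each half, the other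
factor being continuous there. -/
theorem intervalIntegrable_beta {α s t : ℝ} (hα : 0 < α) (hs : 0 < s) (ht : 0 ≤ t) :
    IntervalIntegrable (fun τ : ℝ ↦ (t - τ) ^ (α - 1) * τ ^ (s - 1)) volume 0 t := by
  have h0 : IntervalIntegrable (fun τ : ℝ ↦ τ ^ (s - 1)) volume 0 (t / 2) :=
    intervalIntegral.intervalIntegrable_rpow' (by linarith)
  have h1 : IntervalIntegrable (fun τ : ℝ ↦ (t - τ) ^ (α - 1)) volume (t / 2) t := by
    have := (intervalIntegral.intervalIntegrable_rpow' (a := t / 2) (b := 0) (r := α - 1)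
      (by linarith)).comp_sub_left t
    simpa [sub_half] using this
  rcases ht.eq_or_lt with rfl | ht
  · simp
  refine IntervalIntegrable.trans (b := t / 2) ?_ ?_
  · refine h0.continuousOn_mul (ContinuousOn.rpow_const (by fun_prop) fun x hx ↦ Or.inl ?_)
    rw [uIcc_of_le (by positivity)] at hx
    linarith [hx.2]
  · refine h1.mul_continuousOn (ContinuousOn.rpow_const (by fun_prop) fun x hx ↦ Or.inl ?_)
    rw [uIcc_of_le (by linarith)] at hx
    linarith [hx.1]

theorem integral_beta {α s t : ℝ} (hα : 0 < α) (hs : 0 < s) (ht : 0 < t) :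
    ∫ τ in (0 : ℝ)..t, (t - τ) ^ (α - 1) * τ ^ (s - 1) =
      Real.Gamma α * Real.Gamma s / Real.Gamma (s + α) * t ^ (s + α - 1) := by
  have h := Complex.betaIntegral_scaled (s : ℂ) (α : ℂ) ht
  rw [Complex.betaIntegral_eq_Gamma_mul_div _ _ (by simpa) (by simpa)] at h
  have h2 : ∫ x in (0 : ℝ)..t, (x : ℂ) ^ ((s : ℂ) - 1) * ((t : ℂ) - x) ^ ((α : ℂ) - 1) =
      ((∫ τ in (0 : ℝ)..t, (t - τ) ^ (α - 1) * τ ^ (s - 1) : ℝ) : ℂ) := by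
    rw [← intervalIntegral.integral_ofReal]
    refine intervalIntegral.integral_congr fun x hx ↦ ?_
    rw [uIcc_of_le ht.le] at hx
    rw [mul_comm, Complex.ofReal_mul, Complex.ofReal_cpow (by linarith [hx.2]),
      Complex.ofReal_cpow hx.1]
    push_cast
    rfl
  rw [h2] at h
  have h3 : (t : ℂ) ^ ((s : ℂ) + α - 1) = ((t ^ (s + α - 1) : ℝ) : ℂ) := by
    rw [Complex.ofReal_cpow ht.le]; push_cast; rfl
  rw [h3, ← Complex.ofReal_add, Complex.Gamma_ofReal, Complex.Gamma_ofReal,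
    Complex.Gamma_ofReal] at h
  have h4 := Complex.ofReal_injective (h.trans (by push_cast; rfl :
    _ = ((t ^ (s + α - 1) * (Real.Gamma s * Real.Gamma α / Real.Gamma (s + α)) : ℝ) : ℂ)))
  rw [h4]
  ring

theorem integral_beta_pow {α t : ℝ} (hα : 0 < α) (ht : 0 < t) (k : ℕ) :
    ∫ τ in (0 : ℝ)..t, (t - τ) ^ (α - 1) * (τ ^ α) ^ k =
      Real.Gamma α * Real.Gamma (1 + k * α) / Real.Gamma (1 + (k + 1 : ℕ) * α) *
        (t ^ α) ^ (k + 1) := by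
  have h := integral_beta (s := 1 + k * α) hα (by positivity) ht
  rw [show 1 + k * α + α - 1 = α * (k + 1 : ℕ) by push_cast; ring,
    show 1 + k * α + α = 1 + (k + 1 : ℕ) * α by push_cast; ring, Real.rpow_mul_natCast ht.le] at h
  rw [← h]
  refine intervalIntegral.integral_congr fun τ hτ ↦ ?_
  rw [uIcc_of_le ht.le] at hτ
  rw [show 1 + k * α - 1 = α * k by ring, Real.rpow_mul_natCast hτ.1]

theorem intervalIntegrable_kernel {α : ℝ} (hα : 0 < α) (t : ℝ) (a b : ℝ) :
    IntervalIntegrable (fun τ : ℝ ↦ (t - τ) ^ (α - 1)) volume a b := by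
  have := (intervalIntegral.intervalIntegrable_rpow' (a := t - a) (b := t - b) (r := α - 1)
      (by linarith)).comp_sub_left t
  simpa using this

theorem intervalIntegrable_kernel_mul {α : ℝ} (hα : 0 < α) {f : ℝ → ℝ} (hf : Continuous f)
    (t a b : ℝ) :
    IntervalIntegrable (fun τ : ℝ ↦ (t - τ) ^ (α - 1) * f τ) volume a b :=
  (intervalIntegrable_kernel hα t a b).mul_continuousOn hf.continuousOn

/-- Termwise integration: by the Beta integral, the `k`-th term of the series under the integral
gives the term of index `k + 1`, and the leading `1` is the term of index `0`. The kernel times the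
series at `|l| t^α` dominates. -/
theorem mittagLeffler_volterra {α t : ℝ} (hα₀ : 0 < α) (hα₁ : α < 1) (ht : 0 ≤ t) (l : ℝ) :
    mittagLeffler α (l * t ^ α) = 1 + l / Real.Gamma α *
      ∫ τ in (0 : ℝ)..t, (t - τ) ^ (α - 1) * mittagLeffler α (l * τ ^ α) := by
  rcases ht.eq_or_lt with rfl | ht
  · simp [Real.zero_rpow hα₀.ne', mittagLeffler_zero]
  have hG : Real.Gamma α ≠ 0 := (Real.Gamma_pos_of_pos hα₀).ne'
  let F : ℕ → ℝ → ℝ := fun k τ ↦ (t - τ) ^ (α - 1) * ((l * τ ^ α) ^ k / Real.Gamma (1 + k * α))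
  have hcont : ∀ k : ℕ, Continuous fun τ : ℝ ↦ (l * τ ^ α) ^ k / Real.Gamma (1 + k * α) := by
    have := Real.continuous_rpow_const hα₀.le
    fun_prop
  have hsum : HasSum (fun k ↦ ∫ τ in (0 : ℝ)..t, F k τ)
      (∫ τ in (0 : ℝ)..t, (t - τ) ^ (α - 1) * mittagLeffler α (l * τ ^ α)) := by
    refine intervalIntegral.hasSum_integral_of_dominated_convergence
      (fun k τ ↦ (t - τ) ^ (α - 1) * ((|l| * t ^ α) ^ k / Real.Gamma (1 + k * α)))
      (fun k ↦ (intervalIntegrable_kernel_mul hα₀ (hcont k) t 0 t).def'.aestronglyMeasurable)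
      (fun k ↦ Eventually.of_forall fun τ hτ ↦ ?_)
      (Eventually.of_forall fun τ hτ ↦ ?_) ?_ (Eventually.of_forall fun τ hτ ↦ ?_)
    · rw [uIoc_of_le ht.le] at hτ
      have h1 : 0 ≤ t - τ := by linarith [hτ.2]
      have h2 := Gamma_one_add_mul_pos hα₀ k
      have h3 : 0 ≤ τ ^ α := Real.rpow_nonneg hτ.1.le _
      have h4 : τ ^ α ≤ t ^ α := Real.rpow_le_rpow hτ.1.le hτ.2 hα₀.le
      rw [norm_mul, norm_div, norm_pow, norm_mul, Real.norm_of_nonneg (by positivity),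
        Real.norm_of_nonneg h2.le, Real.norm_of_nonneg h3, Real.norm_eq_abs]
      gcongr
    · exact (summable_mittagLeffler hα₀ hα₁ _).mul_left _
    · simp_rw [tsum_mul_left]
      exact intervalIntegrable_kernel_mul hα₀ continuous_const t 0 t
    · exact (hasSum_mittagLeffler hα₀ hα₁ _).mul_left _
  have hF : ∀ k : ℕ, l / Real.Gamma α * ∫ τ in (0 : ℝ)..t, F k τ =
      (l * t ^ α) ^ (k + 1) / Real.Gamma (1 + (k + 1 : ℕ) * α) := fun k ↦ by
    have : (fun τ ↦ F k τ) = fun τ ↦ l ^ k / Real.Gamma (1 + k * α) *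
        ((t - τ) ^ (α - 1) * (τ ^ α) ^ k) := by
      ext τ
      simp only [F, mul_pow]
      ring
    rw [this, intervalIntegral.integral_const_mul, integral_beta_pow hα₀ ht]
    have h1 := (Gamma_one_add_mul_pos hα₀ k).ne'
    have h2 := (Gamma_one_add_mul_pos hα₀ (k + 1)).ne'
    field_simp
    ring
  have h1 := hsum.mul_left (l / Real.Gamma α)
  simp_rw [hF] at h1
  have h2 := (hasSum_nat_add_iff' 1).mpr (hasSum_mittagLeffler hα₀ hα₁ (l * t ^ α))
  have h3 := h2.unique h1
  simp at h3
  rw [← h3]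
  ring
-- Identity theorem: `E_α` is analytic on the line and `E_α(0) = 1`, so its zeros are isolated.
theorem mittagLeffler_eventually_ne_zero {α : ℝ} (hα₀ : 0 < α) (hα₁ : α < 1) (r : ℝ) :
    ∀ᶠ s in 𝓝[≠] r, mittagLeffler α s ≠ 0 := by
  have hE := analyticOnNhd_mittagLeffler hα₀ hα₁
  refine (hE r (mem_univ r)).eventually_eq_zero_or_eventually_ne_zero.resolve_left fun h ↦ ?_
  have h0 := hE.eqOn_zero_of_preconnected_of_eventuallyEq_zero isPreconnected_univ (mem_univ r) h
  have := h0 (mem_univ (0 : ℝ))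
  rw [mittagLeffler_zero] at this
  exact one_ne_zero this

/-- A continuous solution of `y(t) = 1 - c ∫₀ᵗ (t - τ) ^ (α - 1) y(τ) dτ` which is nonnegative on
`[0, t₀]` and vanishes at `t₀` cannot be negative on an interval `(t₀, t₁]`. -/
theorem nonneg_of_volterra {α c t₀ t₁ : ℝ} {y : ℝ → ℝ} (hα₀ : 0 < α) (hα₁ : α < 1) (hc : 0 ≤ c)
    (hy : Continuous y) (h₀ : 0 ≤ t₀) (h₁ : t₀ < t₁)
    (heq : ∀ t, 0 ≤ t → y t = 1 - c * ∫ τ in (0 : ℝ)..t, (t - τ) ^ (α - 1) * y τ)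
    (hpos : ∀ t ∈ Ico 0 t₀, 0 ≤ y t) (hzero : y t₀ = 0) (hneg : ∀ t ∈ Ioc t₀ t₁, y t ≤ 0) :
    0 ≤ y t₁ := by
  have hI := intervalIntegrable_kernel_mul hα₀ hy
  have h2 : ∫ τ in t₀..t₁, (t₁ - τ) ^ (α - 1) * y τ ≤ 0 := by
    rw [intervalIntegral.integral_of_le h₁.le]
    refine setIntegral_nonpos measurableSet_Ioc fun τ hτ ↦ ?_
    exact mul_nonpos_of_nonneg_of_nonpos (Real.rpow_nonneg (by linarith [hτ.2]) _) (hneg τ hτ)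
  -- The kernel decreases in `t` since `α < 1`. The contribution of the past, where `y ≥ 0`, is thus
  -- no larger at `t₁` than at `t₀`, where it exactly balances the datum `1`.
  have h3 : ∫ τ in (0 : ℝ)..t₀, (t₁ - τ) ^ (α - 1) * y τ ≤
      ∫ τ in (0 : ℝ)..t₀, (t₀ - τ) ^ (α - 1) * y τ := by
    refine intervalIntegral.integral_mono_on_of_le_Ioo h₀ (hI _ _ _) (hI _ _ _) fun τ hτ ↦ ?_
    refine mul_le_mul_of_nonneg_right ?_ (hpos τ ⟨hτ.1.le, hτ.2⟩)
    exact Real.rpow_le_rpow_of_nonpos (by linarith [hτ.2]) (by linarith) (by linarith)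
  have h4 := heq t₀ h₀
  rw [heq t₁ (h₀.trans h₁.le), ← intervalIntegral.integral_add_adjacent_intervals
    (hI t₁ 0 t₀) (hI t₁ t₀ t₁)]
  have h5 := mul_le_mul_of_nonneg_left h2 hc
  have h6 := mul_le_mul_of_nonneg_left h3 hc
  linarith

theorem mittagLeffler_neg_rpow_nonneg {α t : ℝ} (hα₀ : 0 < α) (hα₁ : α < 1) (ht : 0 ≤ t) :
    0 ≤ mittagLeffler α (-t ^ α) := by
  let y : ℝ → ℝ := fun t ↦ mittagLeffler α (-t ^ α)
  have hrpow : Continuous fun t : ℝ ↦ t ^ α := Real.continuous_rpow_const hα₀.le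
  have hy : Continuous y := (continuous_mittagLeffler hα₀ hα₁).comp hrpow.neg
  have hy0 : y 0 = 1 := by simp [y, Real.zero_rpow hα₀.ne', mittagLeffler_zero]
  by_contra! hlt
  let S : Set ℝ := {s | 0 ≤ s ∧ y s < 0}
  have hS : S.Nonempty := ⟨t, ht, hlt⟩
  have hSb : BddBelow S := ⟨0, fun s hs ↦ hs.1⟩
  -- First crossing time: `y ≥ 0` before `t₀`, `y t₀ = 0`, and negative values occur arbitrarily
  -- close to the right of `t₀`.
  set t₀ := sInf S with ht₀
  have h₀ : 0 ≤ t₀ := le_csInf hS fun s hs ↦ hs.1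
  have hpos : ∀ s ∈ Ico 0 t₀, 0 ≤ y s := fun s hs ↦ by
    by_contra! h
    exact absurd (csInf_le hSb ⟨hs.1, h⟩) (not_le.mpr hs.2)
  have hle : y t₀ ≤ 0 := by
    have h := csInf_mem_closure hS hSb
    exact closure_minimal (fun s hs ↦ hs.2.le) (isClosed_Iic.preimage hy) h
  have h₀' : 0 < t₀ := h₀.lt_of_ne fun h ↦ by
    rw [← h, hy0] at hle
    linarith
  have hge : 0 ≤ y t₀ := by
    have h : t₀ ∈ closure (Ico 0 t₀) := by
      rw [closure_Ico h₀'.ne]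
      exact ⟨h₀, le_rfl⟩
    exact closure_minimal hpos (isClosed_Ici.preimage hy) h
  have hzero : y t₀ = 0 := le_antisymm hle hge
  -- Strict monotonicity of `s ↦ s ^ α` transfers isolation of the zeros of `E_α` to `y`: there are
  -- none just to the right of `t₀`.
  have htend : Tendsto (fun s : ℝ ↦ -s ^ α) (𝓝[>] t₀) (𝓝[≠] (-t₀ ^ α)) := by
    refine tendsto_nhdsWithin_iff.mpr ⟨hrpow.neg.continuousWithinAt, ?_⟩
    filter_upwards [self_mem_nhdsWithin] with s hs
    have := Real.rpow_lt_rpow h₀ hs hα₀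
    simp [this.ne']
  obtain ⟨b, hb, hne⟩ := mem_nhdsGT_iff_exists_Ioo_subset.mp
    (htend.eventually (mittagLeffler_eventually_ne_zero hα₀ hα₁ _))
  obtain ⟨t₁, ht₁S, ht₁b⟩ := exists_lt_of_csInf_lt hS hb
  have ht₁ : t₀ < t₁ := (csInf_le hSb ht₁S).lt_of_ne fun h ↦ by
    have := ht₁S.2
    rw [← h] at this
    linarith
  -- A positive value before `t₁` would force a zero in the zero-free interval.
  have hneg : ∀ s ∈ Ioc t₀ t₁, y s ≤ 0 := fun s hs ↦ by
    by_contra! h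
    obtain ⟨z, hz, hz0⟩ := intermediate_value_Icc' hs.2 hy.continuousOn ⟨ht₁S.2.le, h.le⟩
    exact hne ⟨hs.1.trans_le hz.1, hz.2.trans_lt ht₁b⟩ hz0
  have h := nonneg_of_volterra (c := 1 / Real.Gamma α) hα₀ hα₁
    (div_nonneg zero_le_one (Real.Gamma_pos_of_pos hα₀).le) hy h₀ ht₁ (fun s hs ↦ by
      have := mittagLeffler_volterra hα₀ hα₁ hs (-1)
      simp only [neg_one_mul] at this
      simp only [y]
      rw [this]
      ring) hpos hzero hneg
  exact absurd ht₁S.2 (not_lt.mpr h)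

theorem mittagLeffler_nonneg {α : ℝ} (hα₀ : 0 < α) (hα₁ : α < 1) (r : ℝ) :
    0 ≤ mittagLeffler α r := by
  rcases le_total 0 r with hr | hr
  · exact mittagLeffler_nonneg_of_nonneg hα₀ hr
  · have h := mittagLeffler_neg_rpow_nonneg hα₀ hα₁ (Real.rpow_nonneg (neg_nonneg.mpr hr) α⁻¹)
    rwa [← Real.rpow_mul (neg_nonneg.mpr hr), inv_mul_cancel₀ hα₀.ne', Real.rpow_one,
      neg_neg] at h

/-- In the Volterra equation at `t = 1`, the integral is nonnegative and its coefficient `r / Γ(α)`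
is nonpositive. -/
theorem mittagLeffler_le_one {α r : ℝ} (hα₀ : 0 < α) (hα₁ : α < 1) (hr : r ≤ 0) :
    mittagLeffler α r ≤ 1 := by
  have hv := mittagLeffler_volterra hα₀ hα₁ zero_le_one r
  rw [Real.one_rpow, mul_one] at hv
  rw [hv]
  have h : 0 ≤ ∫ τ in (0 : ℝ)..1, (1 - τ) ^ (α - 1) * mittagLeffler α (r * τ ^ α) :=
    intervalIntegral.integral_nonneg zero_le_one fun τ hτ ↦
      mul_nonneg (Real.rpow_nonneg (by linarith [hτ.2]) _) (mittagLeffler_nonneg hα₀ hα₁ _)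
  have := mul_nonpos_of_nonpos_of_nonneg
    (div_nonpos_of_nonpos_of_nonneg hr (Real.Gamma_pos_of_pos hα₀).le) h
  linarith

/-- Monotonicity on the negative half-line is not needed: there `E_α ≤ 1 = E_α(0) ≤ E_α(R)`. -/
theorem mittagLeffler_le {α r R : ℝ} (hα₀ : 0 < α) (hα₁ : α < 1) (hR : 0 ≤ R) (hr : r ≤ R) :
    mittagLeffler α r ≤ mittagLeffler α R := by
  rcases le_total 0 r with h | h
  · exact mittagLeffler_mono hα₀ hα₁ h hr
  · refine (mittagLeffler_le_one hα₀ hα₁ h).trans ?_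
    rw [← mittagLeffler_zero α]
    exact mittagLeffler_mono hα₀ hα₁ le_rfl hR

theorem continuous_symbol (N : ℕ) {α : ℝ} (hα₀ : 0 < α) (hα₁ : α < 1) (d a : ℝ) :
    Continuous fun p : ℝ × EuclideanSpace ℝ (Fin N) ↦ symbol N α d a p.1 p.2 := by
  have hrpow : Continuous fun t : ℝ ↦ t ^ α := Real.continuous_rpow_const hα₀.le
  have := continuous_mittagLeffler hα₀ hα₁
  unfold symbol
  fun_prop

theorem norm_symbol_le {N : ℕ} {α d a T t : ℝ} (hα₀ : 0 < α) (hα₁ : α < 1) (hd : 0 ≤ d)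
    (ha : 0 ≤ a) (ht : t ∈ Icc 0 T) (ξ : EuclideanSpace ℝ (Fin N)) :
    ‖symbol N α d a t ξ‖ ≤ mittagLeffler α (a * T ^ α) := by
  have h0 : 0 ≤ t ^ α := Real.rpow_nonneg ht.1 _
  have h1 : t ^ α ≤ T ^ α := Real.rpow_le_rpow ht.1 ht.2 hα₀.le
  have h2 : 0 ≤ 4 * Real.pi ^ 2 * d * ‖ξ‖ ^ 2 := by positivity
  rw [symbol, Complex.norm_real, Real.norm_of_nonneg (mittagLeffler_nonneg hα₀ hα₁ _)]
  refine mittagLeffler_le hα₀ hα₁ (mul_nonneg ha (h0.trans h1)) ?_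
  exact mul_le_mul (by linarith) h1 h0 ha
-- Density of compactly supported and of band-limited Schwartz functions.
section Cutoff

variable {E F : Type*} [NormedAddCommGroup E] [InnerProductSpace ℝ E]
  [NormedAddCommGroup F] [NormedSpace ℝ F]

/-- A smooth function with bounded derivatives which vanishes near the origin, rescaled to vanish on
larger and larger balls, sends Schwartz functions to `0`. -/
theorem seminorm_smul_comp_smul_le {h : E → ℝ} (hsmooth : ContDiff ℝ ((⊤ : ℕ∞) : WithTop ℕ∞) h)
    (hbdd : ∀ i, ∃ C, ∀ x, ‖iteratedFDeriv ℝ i h x‖ ≤ C) (hzero : ∀ x, ‖x‖ < 1 → h x = 0)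
    (φ : 𝓢(E, F)) (k l : ℕ) :
    ∃ K, ∀ (n : ℕ) (ψ : 𝓢(E, F)), (∀ x, ψ x = h ((n + 1 : ℝ)⁻¹ • x) • φ x) →
      SchwartzMap.seminorm ℝ k l ψ ≤ K / (n + 1) := by
  choose C hC using hbdd
  have hC0 : ∀ i, 0 ≤ C i := fun i ↦ (norm_nonneg _).trans (hC i 0)
  refine ⟨∑ i ∈ Finset.range (l + 1), (l.choose i : ℝ) * C i *
    SchwartzMap.seminorm ℝ (k + 1) (l - i) φ, fun n ψ hψ ↦ ?_⟩
  have hn : (0 : ℝ) < n + 1 := by positivity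
  have hK : 0 ≤ ∑ i ∈ Finset.range (l + 1), (l.choose i : ℝ) * C i *
      SchwartzMap.seminorm ℝ (k + 1) (l - i) φ :=
    Finset.sum_nonneg fun i _ ↦ mul_nonneg (mul_nonneg (by positivity) (hC0 i)) (by positivity)
  have hψ' : (ψ : E → F) = fun x ↦ h ((n + 1 : ℝ)⁻¹ • x) • φ x := funext hψ
  refine SchwartzMap.seminorm_le_bound ℝ k l ψ (by positivity) fun x ↦ ?_
  rcases lt_or_ge ‖x‖ (n + 1) with hx | hx
  · have hev : (ψ : E → F) =ᶠ[𝓝 x] fun _ ↦ 0 := by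
      filter_upwards [continuous_norm.continuousAt.eventually (gt_mem_nhds hx)] with z hz
      rw [hψ, hzero _ _, zero_smul]
      rw [norm_smul, norm_inv, Real.norm_of_nonneg hn.le, inv_mul_lt_iff₀ hn]
      simpa using hz
    rw [(hev.iteratedFDeriv ℝ l).eq_of_nhds]
    have : iteratedFDeriv ℝ l (fun _ : E ↦ (0 : F)) x = 0 := by
      rw [iteratedFDeriv_fun_zero]; rfl
    rw [this, norm_zero, mul_zero]
    positivity
  · let L : E →L[ℝ] E := (n + 1 : ℝ)⁻¹ • ContinuousLinearMap.id ℝ E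
    have hL : ‖L‖ ≤ 1 := by
      refine ContinuousLinearMap.opNorm_le_bound _ zero_le_one fun z ↦ ?_
      simp only [L, smul_apply, ContinuousLinearMap.id_apply, norm_smul]
      gcongr
      rw [norm_inv, Real.norm_of_nonneg hn.le]
      exact inv_le_one_of_one_le₀ (by linarith [n.cast_nonneg (α := ℝ)])
    have hder : ∀ i, ‖iteratedFDeriv ℝ i (h ∘ L) x‖ ≤ C i := fun i ↦ by
      rw [L.iteratedFDeriv_comp_right hsmooth x (mod_cast le_top)]
      refine (ContinuousMultilinearMap.norm_compContinuousLinearMap_le _ _).trans ?_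
      refine (mul_le_of_le_one_right (norm_nonneg _) ?_).trans (hC i _)
      exact Finset.prod_le_one (fun _ _ ↦ norm_nonneg _) fun _ _ ↦ hL
    have hle := norm_iteratedFDeriv_smul_le (𝕜 := ℝ) (f := h ∘ L) (g := φ)
      (N := ((⊤ : ℕ∞) : WithTop ℕ∞))
      (hsmooth.comp L.contDiff) (φ.smooth ⊤) x (n := l) (mod_cast le_top)
    have hψ'' : (ψ : E → F) = fun y ↦ (h ∘ L) y • φ y := hψ'
    rw [hψ'', le_div_iff₀ hn]
    -- On this region `n + 1 ≤ ‖x‖`: the factor `n + 1` is traded for one more power of `‖x‖`,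
    -- whence the seminorms of order `k + 1`.
    calc ‖x‖ ^ k * ‖iteratedFDeriv ℝ l (fun y ↦ (h ∘ L) y • φ y) x‖ * (n + 1)
        ≤ ‖x‖ ^ k * (∑ i ∈ Finset.range (l + 1), (l.choose i : ℝ) *
          ‖iteratedFDeriv ℝ i (h ∘ L) x‖ * ‖iteratedFDeriv ℝ (l - i) φ x‖) * ‖x‖ := by gcongr
      _ = ∑ i ∈ Finset.range (l + 1), (l.choose i : ℝ) * ‖iteratedFDeriv ℝ i (h ∘ L) x‖ *
          (‖x‖ ^ (k + 1) * ‖iteratedFDeriv ℝ (l - i) φ x‖) := by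
        rw [Finset.mul_sum, Finset.sum_mul]
        exact Finset.sum_congr rfl fun i _ ↦ by ring
      _ ≤ _ := Finset.sum_le_sum fun i _ ↦ by
        have h1 := φ.le_seminorm ℝ (k + 1) (l - i) x
        have h2 := hder i
        have h3 := hC0 i
        gcongr

/-- Compactly supported functions are sequentially dense in the Schwartz space. -/
theorem exists_hasCompactSupport_tendsto [FiniteDimensional ℝ E] (φ : 𝓢(E, F)) :
    ∃ ψ : ℕ → 𝓢(E, F), (∀ n, HasCompactSupport (ψ n)) ∧ Tendsto ψ atTop (𝓝 φ) := by
  let χ : ContDiffBump (0 : E) := ⟨1, 2, one_pos, one_lt_two⟩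
  have hχs : ContDiff ℝ ((⊤ : ℕ∞) : WithTop ℕ∞) χ := χ.contDiff
  let L : ℕ → E → E := fun n x ↦ (n + 1 : ℝ)⁻¹ • x
  have hcpt : ∀ n, HasCompactSupport fun x ↦ χ (L n x) • φ x := fun n ↦ by
    have : HasCompactSupport fun x ↦ χ (L n x) :=
      χ.hasCompactSupport.comp_homeomorph (Homeomorph.smulOfNeZero _ (by positivity))
    exact this.smul_right
  let ψ : ℕ → 𝓢(E, F) := fun n ↦ (hcpt n).toSchwartzMap
    ((hχs.comp (contDiff_id.const_smul _)).smul (φ.smooth ⊤))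
  refine ⟨ψ, hcpt, ?_⟩
  rw [(schwartz_withSeminorms ℝ E F).tendsto_nhds]
  rintro ⟨k, l⟩ ε hε
  -- The difference `ψ n - φ` is `φ` times the rescaled `χ - 1`, which vanishes on the ball of
  -- radius `n + 1`.
  obtain ⟨K, hK⟩ := seminorm_smul_comp_smul_le (h := fun x ↦ χ x + -1)
    (hχs.add contDiff_const) (fun i ↦ by
      obtain ⟨C, hC⟩ := (hχs.continuous_iteratedFDeriv (m := i)
        (mod_cast le_top)).bounded_above_of_compact_support (χ.hasCompactSupport.iteratedFDeriv i)
      refine ⟨C + 1, fun x ↦ ?_⟩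
      have h1 : iteratedFDeriv ℝ i (fun x ↦ χ x + -1) x =
          iteratedFDeriv ℝ i χ x + iteratedFDeriv ℝ i (fun _ ↦ (-1 : ℝ)) x :=
        fun_iteratedFDeriv_add_apply (hχs.of_le (mod_cast le_top)).contDiffAt
          contDiff_const.contDiffAt
      have h2 : ‖iteratedFDeriv ℝ i (fun _ : E ↦ (-1 : ℝ)) x‖ ≤ 1 := by
        rcases eq_or_ne i 0 with rfl | hi
        · simp
        · simp [iteratedFDeriv_const_of_ne hi]
      rw [h1]
      exact (norm_add_le _ _).trans (add_le_add (hC x) h2))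
    (fun x hx ↦ by
      rw [χ.one_of_mem_closedBall (by simpa using hx.le), add_neg_cancel]) φ k l
  have hlim : Tendsto (fun n : ℕ ↦ K / ((n : ℝ) + 1)) atTop (𝓝 0) :=
    tendsto_const_nhds.div_atTop (tendsto_atTop_add_const_right _ _ tendsto_natCast_atTop_atTop)
  filter_upwards [hlim.eventually (gt_mem_nhds hε)] with n hn
  refine (hK n _ fun x ↦ ?_).trans_lt hn
  simp [ψ, L, add_smul, sub_eq_add_neg]

end Cutoff

/-- Schwartz functions with compactly supported Fourier transform are sequentially dense in the
Schwartz space. -/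
theorem exists_bandLimited_tendsto {N : ℕ} (φ : 𝓢(EuclideanSpace ℝ (Fin N), ℂ)) :
    ∃ ψ : ℕ → 𝓢(EuclideanSpace ℝ (Fin N), ℂ),
      (∀ n, HasCompactSupport (𝓕 (ψ n) : 𝓢(EuclideanSpace ℝ (Fin N), ℂ))) ∧
        Tendsto ψ atTop (𝓝 φ) := by
  obtain ⟨ψ, hψ, hlim⟩ := exists_hasCompactSupport_tendsto (𝓕 φ)
  refine ⟨fun n ↦ 𝓕⁻ (ψ n), fun n ↦ ?_, ?_⟩
  · simp only [FourierTransform.fourier_fourierInv_eq]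
    exact hψ n
  · have := ((fourierInvCLM ℂ 𝓢(EuclideanSpace ℝ (Fin N), ℂ)).continuous.tendsto (𝓕 φ)).comp hlim
    simpa [Function.comp_def] using this
-- Sobolev spaces on the Fourier side, and functionals given by bounded symbols.
variable {N m : ℕ}

/-- The weight `(1 + |ξ|²) ^ (m / 2)` on the Fourier side of `H ^ m`. -/
noncomputable def weight (N m : ℕ) (ξ : EuclideanSpace ℝ (Fin N)) : ℝ :=
  (1 + ‖ξ‖ ^ 2) ^ ((m : ℝ) / 2)

theorem weight_pos (ξ : EuclideanSpace ℝ (Fin N)) : 0 < weight N m ξ := by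
  unfold weight
  positivity

theorem hasTemperateGrowth_weight : (weight N m).HasTemperateGrowth :=
  Function.hasTemperateGrowth_one_add_norm_sq_rpow _ ((m : ℝ) / 2)

theorem continuous_weight : Continuous (weight N m) :=
  hasTemperateGrowth_weight.1.continuous

theorem fourier_fourierMultiplier_weight (φ : 𝓢(EuclideanSpace ℝ (Fin N), ℂ)) :
    𝓕 (SchwartzMap.fourierMultiplierCLM ℂ (weight N m) φ) =
      SchwartzMap.smulLeftCLM ℂ (weight N m) (𝓕 φ) := by
  rw [SchwartzMap.fourierMultiplierCLM_apply, FourierTransform.fourier_fourierInv_eq]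

/-- Plancherel's theorem: the `H^m` norm is a weighted `L²` norm of the Fourier transform, so
multiplier bounds can be checked pointwise in `ξ`. -/
theorem norm_ofSchwartz (φ : 𝓢(EuclideanSpace ℝ (Fin N), ℂ)) :
    ‖Sobolev.ofSchwartz (m := m) φ‖ =
      ‖(SchwartzMap.smulLeftCLM ℂ (weight N m) (𝓕 φ)).toLp 2‖ := by
  have h := Sobolev.bessel_ofSchwartz (m := m) φ
  rw [Sobolev.norm_eq]
  change ‖Sobolev.bessel (Sobolev.ofSchwartzₗ (m := m) φ)‖ = _
  rw [h, SchwartzMap.toLpCLM_apply, ← SchwartzMap.norm_fourier_toL2_eq]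
  change ‖(𝓕 (SchwartzMap.fourierMultiplierCLM ℂ (weight N m) φ)).toLp 2‖ = _
  rw [fourier_fourierMultiplier_weight]

/-- The operator `d Δ + a` on Schwartz functions. -/
noncomputable def reactionDiffusion (d a : ℝ) (φ : 𝓢(EuclideanSpace ℝ (Fin N), ℂ)) :
    𝓢(EuclideanSpace ℝ (Fin N), ℂ) :=
  (d : ℂ) • Δ φ + (a : ℂ) • φ

theorem fourier_laplacian_apply (φ : 𝓢(EuclideanSpace ℝ (Fin N), ℂ))
    (ξ : EuclideanSpace ℝ (Fin N)) :
    𝓕 (Δ φ) ξ = ((-(4 * Real.pi ^ 2 * ‖ξ‖ ^ 2) : ℝ) : ℂ) * 𝓕 φ ξ := by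
  have hg : (fun x : EuclideanSpace ℝ (Fin N) ↦ ‖x‖ ^ 2).HasTemperateGrowth := by fun_prop
  rw [SchwartzMap.laplacian_eq_fourierMultiplierCLM, FourierTransform.fourier_smul,
    SchwartzMap.fourierMultiplierCLM_apply, FourierTransform.fourier_fourierInv_eq,
    smul_apply]
  change -(2 * Real.pi) ^ 2 • (SchwartzMap.smulLeftCLM ℂ
    (fun x : EuclideanSpace ℝ (Fin N) ↦ ‖x‖ ^ 2) (𝓕 φ)) ξ = _
  rw [SchwartzMap.smulLeftCLM_apply_apply hg, smul_smul, Complex.real_smul]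
  congr 2
  ring

theorem fourier_reactionDiffusion_apply (d a : ℝ) (φ : 𝓢(EuclideanSpace ℝ (Fin N), ℂ))
    (ξ : EuclideanSpace ℝ (Fin N)) :
    𝓕 (reactionDiffusion d a φ) ξ =
      ((a - 4 * Real.pi ^ 2 * d * ‖ξ‖ ^ 2 : ℝ) : ℂ) * 𝓕 φ ξ := by
  rw [reactionDiffusion, FourierTransform.fourier_add, FourierTransform.fourier_smul,
    FourierTransform.fourier_smul, add_apply, smul_apply, smul_apply, fourier_laplacian_apply]
  simp only [smul_eq_mul]
  push_cast
  ring

theorem fourierInv_apply_eq_fourier_neg (φ : 𝓢(EuclideanSpace ℝ (Fin N), ℂ))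
    (ξ : EuclideanSpace ℝ (Fin N)) : 𝓕⁻ φ ξ = 𝓕 φ (-ξ) := by
  rw [SchwartzMap.fourierInv_apply_eq]
  rfl

theorem fourierInv_reactionDiffusion_apply (d a : ℝ) (φ : 𝓢(EuclideanSpace ℝ (Fin N), ℂ))
    (ξ : EuclideanSpace ℝ (Fin N)) :
    𝓕⁻ (reactionDiffusion d a φ) ξ =
      ((a - 4 * Real.pi ^ 2 * d * ‖ξ‖ ^ 2 : ℝ) : ℂ) * 𝓕⁻ φ ξ := by
  rw [fourierInv_apply_eq_fourier_neg, fourier_reactionDiffusion_apply, norm_neg,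
    fourierInv_apply_eq_fourier_neg]

theorem NegSobolev.apply_reactionDiffusion (u : NegSobolev N m) (d a : ℝ)
    (φ : 𝓢(EuclideanSpace ℝ (Fin N), ℂ)) :
    u (Sobolev.ofSchwartz (reactionDiffusion d a φ)) =
      d * u (Sobolev.ofSchwartz (Δ φ)) + a * u (Sobolev.ofSchwartz φ) := by
  simp [reactionDiffusion]

theorem continuous_reactionDiffusion (d a : ℝ) :
    Continuous (reactionDiffusion (N := N) d a) := by
  have h : Continuous fun φ : 𝓢(EuclideanSpace ℝ (Fin N), ℂ) ↦ Δ φ := by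
    simp_rw [SchwartzMap.laplacian_eq_fourierMultiplierCLM]
    exact (SchwartzMap.fourierMultiplierCLM ℂ
      ((‖·‖ ^ 2 : EuclideanSpace ℝ (Fin N) → ℝ))).continuous.const_smul
        (-(2 * Real.pi) ^ 2 : ℝ)
  unfold reactionDiffusion
  fun_prop

/-- The multiplier `a - 4π²d|ξ|²` is bounded on the ball of radius `R`, which carries `𝓕 φ`. This
bound is why uniqueness is tested on band-limited functions. -/
theorem norm_ofSchwartz_reactionDiffusion_le {d a R : ℝ} (hd : 0 ≤ d) (ha : 0 ≤ a)
    (φ : 𝓢(EuclideanSpace ℝ (Fin N), ℂ)) (hφ : ∀ ξ, R < ‖ξ‖ → 𝓕 φ ξ = 0) :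
    ‖Sobolev.ofSchwartz (m := m) (reactionDiffusion d a φ)‖ ≤
      (a + 4 * Real.pi ^ 2 * d * R ^ 2) * ‖Sobolev.ofSchwartz (m := m) φ‖ := by
  rw [norm_ofSchwartz, norm_ofSchwartz]
  have hw := hasTemperateGrowth_weight (N := N) (m := m)
  refine Lp.norm_le_mul_norm_of_ae_le_mul ?_
  filter_upwards [SchwartzMap.coeFn_toLp (SchwartzMap.smulLeftCLM ℂ (weight N m)
    (𝓕 (reactionDiffusion d a φ))) 2, SchwartzMap.coeFn_toLp
    (SchwartzMap.smulLeftCLM ℂ (weight N m) (𝓕 φ)) 2] with ξ h1 h2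
  rw [h1, h2, SchwartzMap.smulLeftCLM_apply_apply hw, SchwartzMap.smulLeftCLM_apply_apply hw,
    fourier_reactionDiffusion_apply]
  rcases lt_or_ge R ‖ξ‖ with h | h
  · simp [hφ ξ h]
  · rw [norm_smul, norm_mul, norm_smul, Complex.norm_real]
    have h3 : ‖a - 4 * Real.pi ^ 2 * d * ‖ξ‖ ^ 2‖ ≤ a + 4 * Real.pi ^ 2 * d * R ^ 2 := by
      refine (norm_sub_le _ _).trans ?_
      rw [Real.norm_of_nonneg ha, Real.norm_of_nonneg (by positivity)]
      gcongr
    calc _ = ‖a - 4 * Real.pi ^ 2 * d * ‖ξ‖ ^ 2‖ * (‖weight N m ξ‖ * ‖𝓕 φ ξ‖) := by ring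
      _ ≤ _ := by gcongr

/-- Since `bessel` is an isometry, it suffices that it maps Schwartz functions onto Schwartz
functions, which are dense in `L²`; the preimage is the multiplier with the inverse weight. -/
theorem denseRange_ofSchwartz : DenseRange (Sobolev.ofSchwartz (N := N) (m := m)) := by
  have hdense : DenseRange (SchwartzMap.toLpCLM ℂ (E := EuclideanSpace ℝ (Fin N)) ℂ 2 volume) :=
    SchwartzMap.denseRange_toLpCLM ENNReal.ofNat_ne_top
  have hinv : (fun ξ : EuclideanSpace ℝ (Fin N) ↦ (weight N m ξ)⁻¹).HasTemperateGrowth := by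
    have := Function.hasTemperateGrowth_one_add_norm_sq_rpow
      (EuclideanSpace ℝ (Fin N)) (-((m : ℝ) / 2))
    have heq : (fun ξ : EuclideanSpace ℝ (Fin N) ↦ (weight N m ξ)⁻¹) =
        fun ξ ↦ (1 + ‖ξ‖ ^ 2) ^ (-((m : ℝ) / 2)) := funext fun ξ ↦ by
      rw [Real.rpow_neg (by positivity), weight]
    rw [heq]
    exact this
  have hsurj : ∀ ψ : 𝓢(EuclideanSpace ℝ (Fin N), ℂ), ∃ φ : 𝓢(EuclideanSpace ℝ (Fin N), ℂ),
      Sobolev.bessel (Sobolev.ofSchwartz (m := m) φ) = SchwartzMap.toLpCLM ℂ ℂ 2 volume ψ := by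
    intro ψ
    refine ⟨SchwartzMap.fourierMultiplierCLM ℂ (fun ξ ↦ (weight N m ξ)⁻¹) ψ, ?_⟩
    refine (Sobolev.bessel_ofSchwartz (m := m) _).trans ?_
    change SchwartzMap.toLpCLM ℂ ℂ 2 volume (SchwartzMap.fourierMultiplierCLM ℂ (weight N m)
      (SchwartzMap.fourierMultiplierCLM ℂ (fun ξ ↦ (weight N m ξ)⁻¹) ψ)) = _
    rw [SchwartzMap.fourierMultiplierCLM_fourierMultiplierCLM_apply hasTemperateGrowth_weight hinv]
    have : weight N m * (fun ξ ↦ (weight N m ξ)⁻¹) = fun _ ↦ 1 :=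
      funext fun ξ ↦ mul_inv_cancel₀ (weight_pos ξ).ne'
    rw [this]
    simp
  intro f
  rw [Metric.mem_closure_range_iff]
  intro ε hε
  obtain ⟨ψ, hψ⟩ := Metric.mem_closure_range_iff.mp (hdense (Sobolev.bessel f)) ε hε
  obtain ⟨φ, hφ⟩ := hsurj ψ
  refine ⟨φ, ?_⟩
  rw [← Sobolev.isometry_bessel.dist_eq, hφ]
  exact hψ

/-- The condition `m > N / 2` enters here: it makes `(1 + |ξ|²)^(-m)` integrable. -/
theorem memLp_inv_weight (hm : (N : ℝ) / 2 < m) :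
    MemLp (fun ξ ↦ (weight N m ξ)⁻¹) 2 (volume : Measure (EuclideanSpace ℝ (Fin N))) := by
  have hc : Continuous fun ξ ↦ (weight N m ξ)⁻¹ :=
    continuous_weight.inv₀ fun ξ ↦ (weight_pos ξ).ne'
  rw [memLp_two_iff_integrable_sq hc.aestronglyMeasurable]
  have h := integrable_rpow_neg_one_add_norm_sq (E := EuclideanSpace ℝ (Fin N))
    (μ := volume) (r := 2 * m) (by simp; linarith)
  refine h.congr (Eventually.of_forall fun ξ ↦ ?_)
  simp only [weight]
  rw [inv_pow, ← Real.rpow_mul_natCast (by positivity), ← Real.rpow_neg (by positivity)]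
  congr 1
  push_cast
  ring

/-- The map `f ↦ 𝓕⁻ (bessel f)` from `H ^ m` to `L ^ 2`. -/
noncomputable def Sobolev.fourierInvBessel (N m : ℕ) :
    Sobolev N m →L[ℂ] Lp ℂ 2 (volume : Measure (EuclideanSpace ℝ (Fin N))) :=
  LinearMap.mkContinuous ((Lp.fourierTransformₗᵢ (EuclideanSpace ℝ (Fin N)) ℂ).symm.toLinearEquiv ∘ₗ
    Sobolev.bessel) 1 fun f ↦ by
      rw [one_mul, Sobolev.norm_eq]
      simp

theorem Sobolev.norm_fourierInvBessel_le : ‖Sobolev.fourierInvBessel N m‖ ≤ 1 :=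
  LinearMap.mkContinuous_norm_le _ zero_le_one _

theorem Sobolev.fourierInvBessel_ofSchwartz (φ : 𝓢(EuclideanSpace ℝ (Fin N), ℂ)) :
    Sobolev.fourierInvBessel N m (Sobolev.ofSchwartz φ) =
      (SchwartzMap.smulLeftCLM ℂ (weight N m) (𝓕⁻ φ)).toLp 2 := by
  have hw := hasTemperateGrowth_weight (N := N) (m := m)
  change 𝓕⁻ (Sobolev.bessel (Sobolev.ofSchwartzₗ (m := m) φ)) = _
  rw [Sobolev.bessel_ofSchwartz, SchwartzMap.toLpCLM_apply, SchwartzMap.toLp_fourierInv_eq]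
  congr 1
  ext ξ
  rw [fourierInv_apply_eq_fourier_neg]
  change 𝓕 (SchwartzMap.fourierMultiplierCLM ℂ (weight N m) φ) (-ξ) = _
  rw [fourier_fourierMultiplier_weight, SchwartzMap.smulLeftCLM_apply_apply hw,
    SchwartzMap.smulLeftCLM_apply_apply hw, fourierInv_apply_eq_fourier_neg, weight, norm_neg]
  rfl

/-- A bounded Fourier symbol defines an element of `H ^ {-m}` for `m > N / 2`, with a bound on its
norm that depends only on the bound on the symbol. -/
theorem NegSobolev.exists_of_bounded_symbol (hm : (N : ℝ) / 2 < m) : ∃ K : ℝ, 0 ≤ K ∧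
    ∀ (σ : EuclideanSpace ℝ (Fin N) → ℂ) (B : ℝ), AEStronglyMeasurable σ volume → 0 ≤ B →
      (∀ ξ, ‖σ ξ‖ ≤ B) → ∃ u : NegSobolev N m, ‖u‖ ≤ B * K ∧
        ∀ φ, u (Sobolev.ofSchwartz φ) = ∫ ξ, σ ξ * 𝓕⁻ φ ξ := by
  have hw := memLp_inv_weight hm
  -- Write `∫ σ 𝓕⁻φ` as the `L²` pairing of `σ / weight` with `weight · 𝓕⁻φ`; the latter is
  -- `fourierInvBessel` of `φ`, of norm at most that of `φ`. The conjugate on `σ` cancels the one in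
  -- the inner product.
  refine ⟨‖hw.toLp _‖, norm_nonneg _, fun σ B hσ hB hσB ↦ ?_⟩
  have hle : ∀ ξ, ‖(weight N m ξ)⁻¹ • (starRingEnd ℂ) (σ ξ)‖ ≤ B * ‖(weight N m ξ)⁻¹‖ :=
    fun ξ ↦ by
      rw [norm_smul, RCLike.norm_conj, mul_comm]
      gcongr
      exact hσB ξ
  have hg : MemLp (fun ξ ↦ (weight N m ξ)⁻¹ • (starRingEnd ℂ) (σ ξ)) 2 volume :=
    hw.of_le_mul (hw.1.smul (Complex.continuous_conj.comp_aestronglyMeasurable hσ))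
      (Eventually.of_forall hle)
  have hgn : ‖hg.toLp _‖ ≤ B * ‖hw.toLp _‖ := by
    refine Lp.norm_le_mul_norm_of_ae_le_mul ?_
    filter_upwards [hg.coeFn_toLp, hw.coeFn_toLp] with ξ h1 h2
    rw [h1, h2]
    exact hle ξ
  refine ⟨innerSL ℂ (hg.toLp _) ∘L Sobolev.fourierInvBessel N m, ?_, fun φ ↦ ?_⟩
  · refine (ContinuousLinearMap.opNorm_comp_le _ _).trans ?_
    rw [innerSL_apply_norm]
    exact (mul_le_of_le_one_right (norm_nonneg _) Sobolev.norm_fourierInvBessel_le).trans hgn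
  · change inner ℂ (hg.toLp _) (Sobolev.fourierInvBessel N m (Sobolev.ofSchwartz φ)) = _
    rw [Sobolev.fourierInvBessel_ofSchwartz, L2.inner_def]
    refine integral_congr_ae ?_
    filter_upwards [hg.coeFn_toLp, SchwartzMap.coeFn_toLp
      (SchwartzMap.smulLeftCLM ℂ (weight N m) (𝓕⁻ φ)) 2] with ξ h1 h2
    rw [h1, h2, SchwartzMap.smulLeftCLM_apply_apply hasTemperateGrowth_weight]
    have hne : ((weight N m ξ : ℝ) : ℂ) ≠ 0 := by exact_mod_cast (weight_pos ξ).ne'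
    simp only [RCLike.inner_apply, Complex.real_smul, map_mul, Complex.conj_conj,
      Complex.ofReal_inv, map_inv₀, Complex.conj_ofReal]
    field_simp

theorem NegSobolev.toDistribution_eq_fourierInv {σ : EuclideanSpace ℝ (Fin N) → ℂ}
    (hσ : MemLp σ ∞ volume) (u : NegSobolev N m)
    (hu : ∀ φ, u (Sobolev.ofSchwartz φ) = ∫ ξ, σ ξ * 𝓕⁻ φ ξ) :
    u.toDistribution = 𝓕⁻ (hσ.toLp _ : 𝓢'(EuclideanSpace ℝ (Fin N), ℂ)) := by
  ext φ
  rw [TemperedDistribution.fourierInv_apply, Lp.toTemperedDistribution_apply]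
  change u (Sobolev.ofSchwartz φ) = _
  rw [hu]
  refine integral_congr_ae ?_
  filter_upwards [hσ.coeFn_toLp] with ξ h
  rw [h, smul_eq_mul, mul_comm]
-- Existence: the symbol yields a solution.
theorem div_kernel_eq {α t τ : ℝ} (hτ : τ ≤ t) (z : ℂ) :
    z / (((t - τ) ^ (1 - α) : ℝ) : ℂ) = (((t - τ) ^ (α - 1) : ℝ) : ℂ) * z := by
  rw [← neg_sub 1 α, Real.rpow_neg (sub_nonneg.mpr hτ), Complex.ofReal_inv, div_eq_inv_mul]

theorem integral_div_kernel_eq {α t : ℝ} (ht : 0 ≤ t) (f : ℝ → ℂ) :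
    ∫ τ in (0 : ℝ)..t, f τ / (((t - τ) ^ (1 - α) : ℝ) : ℂ) =
      ∫ τ in (0 : ℝ)..t, (((t - τ) ^ (α - 1) : ℝ) : ℂ) * f τ := by
  refine intervalIntegral.integral_congr fun τ hτ ↦ ?_
  rw [uIcc_of_le ht] at hτ
  exact div_kernel_eq hτ.2 _

theorem intervalIntegrable_div_kernel_iff {α t : ℝ} (ht : 0 ≤ t) (f : ℝ → ℂ) :
    IntervalIntegrable (fun τ ↦ f τ / (((t - τ) ^ (1 - α) : ℝ) : ℂ)) volume 0 t ↔
      IntervalIntegrable (fun τ ↦ (((t - τ) ^ (α - 1) : ℝ) : ℂ) * f τ) volume 0 t := by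
  refine intervalIntegrable_congr fun τ hτ ↦ ?_
  rw [uIoc_of_le ht] at hτ
  exact div_kernel_eq hτ.2 _

section Existence

variable {α d a : ℝ}

/-- Fourier inversion at the origin: the constant symbol `1` represents the datum `δ`. -/
theorem integral_fourierInv (φ : 𝓢(EuclideanSpace ℝ (Fin N), ℂ)) : ∫ ξ, 𝓕⁻ φ ξ = φ 0 := by
  have h : 𝓕 (𝓕⁻ φ) 0 = φ 0 := by rw [FourierTransform.fourier_fourierInv_eq]
  rw [← h, SchwartzMap.fourier_coe, Real.fourier_eq]
  simp

theorem symbol_volterra (hα₀ : 0 < α) (hα₁ : α < 1) {t : ℝ} (ht : 0 ≤ t)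
    (ξ : EuclideanSpace ℝ (Fin N)) :
    symbol N α d a t ξ = 1 + 1 / (Real.Gamma α : ℂ) *
      ∫ τ in (0 : ℝ)..t, (((t - τ) ^ (α - 1) : ℝ) : ℂ) *
        (symbol N α d a τ ξ * ((a - 4 * Real.pi ^ 2 * d * ‖ξ‖ ^ 2 : ℝ) : ℂ)) := by
  rw [symbol, mittagLeffler_volterra hα₀ hα₁ ht]
  simp only [symbol, ← Complex.ofReal_mul]
  rw [intervalIntegral.integral_ofReal]
  norm_cast
  simp only [← mul_assoc]
  rw [intervalIntegral.integral_mul_const]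
  ring

variable {T : ℝ}

/-- The hypothesis of Fubini's theorem: an integrable kernel in `τ` times a Schwartz function in
`ξ`, times a bounded symbol. -/
theorem integrable_kernel_symbol (hα₀ : 0 < α) (hα₁ : α < 1) (hd : 0 ≤ d) (ha : 0 ≤ a)
    {t : ℝ} (ht : t ∈ Icc 0 T) (χ : 𝓢(EuclideanSpace ℝ (Fin N), ℂ)) :
    Integrable (fun p : ℝ × EuclideanSpace ℝ (Fin N) ↦
      (((t - p.1) ^ (α - 1) : ℝ) : ℂ) * (symbol N α d a p.1 p.2 * χ p.2))
      ((volume.restrict (Ioc 0 t)).prod volume) := by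
  have hk : Integrable (fun τ : ℝ ↦ (((t - τ) ^ (α - 1) : ℝ) : ℂ)) (volume.restrict (Ioc 0 t)) :=
    ((intervalIntegrable_iff_integrableOn_Ioc_of_le ht.1).mp
      (intervalIntegrable_kernel hα₀ t 0 t)).ofReal
  have hσ : AEStronglyMeasurable
      (fun p : ℝ × EuclideanSpace ℝ (Fin N) ↦ symbol N α d a p.1 p.2)
      ((volume.restrict (Ioc 0 t)).prod volume) :=
    (continuous_symbol N hα₀ hα₁ d a).aestronglyMeasurable
  have hmem : ∀ᵐ p ∂((volume.restrict (Ioc 0 t)).prod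
      (volume : Measure (EuclideanSpace ℝ (Fin N)))), p.1 ∈ Ioc 0 t :=
    Measure.quasiMeasurePreserving_fst.ae (ae_restrict_mem measurableSet_Ioc)
  have hbd : ∀ᵐ p ∂((volume.restrict (Ioc 0 t)).prod
      (volume : Measure (EuclideanSpace ℝ (Fin N)))),
      ‖symbol N α d a p.1 p.2‖ ≤ mittagLeffler α (a * T ^ α) :=
    hmem.mono fun p hp ↦ norm_symbol_le hα₀ hα₁ hd ha ⟨hp.1.le, hp.2.trans ht.2⟩ _
  have h := (hk.mul_prod χ.integrable).bdd_mul hσ hbd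
  exact h.congr (Eventually.of_forall fun p ↦ mul_left_comm _ _ _)

theorem isSolution_of_symbol (hα₀ : 0 < α) (hα₁ : α < 1) (hd : 0 ≤ d) (ha : 0 ≤ a)
    {u : ℝ → NegSobolev N m} (hu : MemLinfWeighted α T u)
    (hsymb : ∀ t ∈ Icc 0 T, ∀ φ,
      u t (Sobolev.ofSchwartz φ) = ∫ ξ, symbol N α d a t ξ * 𝓕⁻ φ ξ) :
    IsSolution α d a T u := by
  have hslice : ∀ φ : 𝓢(EuclideanSpace ℝ (Fin N), ℂ), ∀ t ∈ Icc 0 T, ∀ τ ∈ Ioc 0 t,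
      (((t - τ) ^ (α - 1) : ℝ) : ℂ) *
          (d * u τ (Sobolev.ofSchwartz (Δ φ)) + a * u τ (Sobolev.ofSchwartz φ)) =
        ∫ ξ, (((t - τ) ^ (α - 1) : ℝ) : ℂ) *
          (symbol N α d a τ ξ * 𝓕⁻ (reactionDiffusion d a φ) ξ) := fun φ t ht τ hτ ↦ by
    rw [← NegSobolev.apply_reactionDiffusion, hsymb τ ⟨hτ.1.le, hτ.2.trans ht.2⟩,
      integral_const_mul]
  refine ⟨hu, fun φ _ t ht ↦ ?_, fun φ _ t ht ↦ ?_⟩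
  · rw [intervalIntegrable_div_kernel_iff ht.1, intervalIntegrable_iff_integrableOn_Ioc_of_le ht.1]
    refine (integrable_kernel_symbol hα₀ hα₁ hd ha ht
      (𝓕⁻ (reactionDiffusion d a φ))).integral_prod_left.congr ?_
    filter_upwards [ae_restrict_mem measurableSet_Ioc] with τ hτ
    exact (hslice φ t ht τ hτ).symm
  · have hint := integrable_kernel_symbol hα₀ hα₁ hd ha ht (𝓕⁻ (reactionDiffusion d a φ))
    rw [integral_div_kernel_eq ht.1, intervalIntegral.integral_of_le ht.1,
      setIntegral_congr_fun measurableSet_Ioc (hslice φ t ht), integral_integral_swap hint,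
      ← integral_fourierInv φ, ← integral_const_mul, ← integral_add (𝓕⁻ φ).integrable
        (hint.integral_prod_right.const_mul _), hsymb t ht]
    refine integral_congr_ae (Eventually.of_forall fun ξ ↦ ?_)
    simp only
    rw [symbol_volterra hα₀ hα₁ ht.1, intervalIntegral.integral_of_le ht.1, add_mul, one_mul,
      mul_assoc, ← integral_mul_const]
    simp only [fourierInv_reactionDiffusion_apply, mul_assoc]

theorem exists_isSolution (hm : (N : ℝ) / 2 < m) (hα₀ : 0 < α) (hα₁ : α < 1) (hd : 0 ≤ d)
    (ha : 0 ≤ a) : ∃ u : ℝ → NegSobolev N m, IsSolution α d a T u ∧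
      ∀ t ∈ Icc 0 T, ∀ φ, u t (Sobolev.ofSchwartz φ) = ∫ ξ, symbol N α d a t ξ * 𝓕⁻ φ ξ := by
  obtain ⟨K, hK, hex⟩ := NegSobolev.exists_of_bounded_symbol (N := N) hm
  have hB : 0 ≤ mittagLeffler α (a * T ^ α) := mittagLeffler_nonneg hα₀ hα₁ _
  have hσ : ∀ t, ∃ u : NegSobolev N m, t ∈ Icc 0 T → ‖u‖ ≤ mittagLeffler α (a * T ^ α) * K ∧
      ∀ φ, u (Sobolev.ofSchwartz φ) = ∫ ξ, symbol N α d a t ξ * 𝓕⁻ φ ξ := fun t ↦ by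
    by_cases ht : t ∈ Icc 0 T
    · obtain ⟨u, hu⟩ := hex (symbol N α d a t) _ ((continuous_symbol N hα₀ hα₁ d a).comp
        (Continuous.prodMk_right t)).aestronglyMeasurable hB (norm_symbol_le hα₀ hα₁ hd ha ht)
      exact ⟨u, fun _ ↦ hu⟩
    -- Values outside `[0, T]` play no role.
    · exact ⟨0, fun h ↦ absurd h ht⟩
  choose u hu using hσ
  refine ⟨u, isSolution_of_symbol hα₀ hα₁ hd ha ?_ fun t ht ↦ (hu t ht).2, fun t ht ↦ (hu t ht).2⟩
  refine ⟨T ^ α * (mittagLeffler α (a * T ^ α) * K), ?_⟩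
  rintro _ ⟨t, ht, rfl⟩
  exact mul_le_mul (Real.rpow_le_rpow ht.1 ht.2 hα₀.le) (hu t ht).1 (norm_nonneg _)
    (Real.rpow_nonneg (ht.1.trans ht.2) _)

end Existence

/-! ### Uniqueness: iteration of the homogeneous Volterra equation. -/

section Uniqueness

variable {α d a T : ℝ}

/-- Time `0` is excluded: as `0 ^ α = 0`, the weighted bound says nothing about `u 0`. -/
theorem MemLinfWeighted.exists_norm_le {u : ℝ → NegSobolev N m} (hu : MemLinfWeighted α T u) :
    ∃ M, 0 ≤ M ∧ ∀ t ∈ Ioc 0 T, ‖u t‖ ≤ M * t ^ (-α) := by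
  obtain ⟨M, hM⟩ := hu
  refine ⟨max M 0, le_max_right _ _, fun t ht ↦ ?_⟩
  have h : t ^ α * ‖u t‖ ≤ M := hM ⟨t, Ioc_subset_Icc_self ht, rfl⟩
  rw [Real.rpow_neg ht.1.le, ← div_eq_mul_inv, le_div_iff₀ (Real.rpow_pos_of_pos ht.1 _), mul_comm]
  exact h.trans (le_max_left _ _)

/-- The Volterra equation without initial datum, tested against `φ`. -/
def VolterraEq (α d a T : ℝ) (w : ℝ → NegSobolev N m)
    (φ : 𝓢(EuclideanSpace ℝ (Fin N), ℂ)) : Prop :=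
  ∀ t ∈ Icc 0 T, w t (Sobolev.ofSchwartz φ) = 1 / (Real.Gamma α : ℂ) * ∫ τ in (0 : ℝ)..t,
    (((t - τ) ^ (α - 1) : ℝ) : ℂ) * w τ (Sobolev.ofSchwartz (reactionDiffusion d a φ))

theorem IsSolution.intervalIntegrable {u : ℝ → NegSobolev N m} (hu : IsSolution α d a T u)
    {φ : 𝓢(EuclideanSpace ℝ (Fin N), ℂ)} (hφ : HasCompactSupport φ) {t : ℝ} (ht : t ∈ Icc 0 T) :
    IntervalIntegrable (fun τ ↦ (((t - τ) ^ (α - 1) : ℝ) : ℂ) *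
      u τ (Sobolev.ofSchwartz (reactionDiffusion d a φ))) volume 0 t := by
  simp only [NegSobolev.apply_reactionDiffusion]
  exact (intervalIntegrable_div_kernel_iff ht.1 _).mp (hu.integrable φ hφ t ht)

theorem IsSolution.eq {u : ℝ → NegSobolev N m} (hu : IsSolution α d a T u)
    {φ : 𝓢(EuclideanSpace ℝ (Fin N), ℂ)} (hφ : HasCompactSupport φ) {t : ℝ} (ht : t ∈ Icc 0 T) :
    u t (Sobolev.ofSchwartz φ) = φ 0 + 1 / (Real.Gamma α : ℂ) * ∫ τ in (0 : ℝ)..t,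
      (((t - τ) ^ (α - 1) : ℝ) : ℂ) * u τ (Sobolev.ofSchwartz (reactionDiffusion d a φ)) := by
  simp only [NegSobolev.apply_reactionDiffusion]
  rw [← integral_div_kernel_eq ht.1]
  exact hu.equation φ hφ t ht

theorem IsSolution.volterraEq_sub {u v : ℝ → NegSobolev N m} (hu : IsSolution α d a T u)
    (hv : IsSolution α d a T v) {φ : 𝓢(EuclideanSpace ℝ (Fin N), ℂ)} (hφ : HasCompactSupport φ) :
    VolterraEq α d a T (u - v) φ := fun t ht ↦ by
  simp only [Pi.sub_apply, sub_apply, mul_sub]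
  rw [intervalIntegral.integral_sub (hu.intervalIntegrable hφ ht) (hv.intervalIntegrable hφ ht),
    hu.eq hφ ht, hv.eq hφ ht]
  ring

theorem norm_kernel_mul_apply_le {w : ℝ → NegSobolev N m} {t τ X b : ℝ} {f : Sobolev N m}
    (hτ : τ ≤ t) (h : ‖w τ f‖ ≤ b * X) :
    ‖(((t - τ) ^ (α - 1) : ℝ) : ℂ) * w τ f‖ ≤ b * ((t - τ) ^ (α - 1) * X) := by
  have h0 := Real.rpow_nonneg (sub_nonneg.mpr hτ) (α - 1)
  rw [norm_mul, Complex.norm_real, Real.norm_of_nonneg h0]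
  calc _ ≤ (t - τ) ^ (α - 1) * (b * X) := by gcongr
    _ = _ := by ring

/-- A Volterra equation that holds for all compactly supported test functions holds for all Schwartz
functions. -/
theorem VolterraEq.of_hasCompactSupport (hα₀ : 0 < α) (hα₁ : α < 1) {w : ℝ → NegSobolev N m}
    {M : ℝ} (hM : ∀ t ∈ Ioc 0 T, ‖w t‖ ≤ M * t ^ (-α))
    (hint : ∀ φ : 𝓢(EuclideanSpace ℝ (Fin N), ℂ), HasCompactSupport φ → ∀ t ∈ Icc 0 T,
      IntervalIntegrable (fun τ ↦ (((t - τ) ^ (α - 1) : ℝ) : ℂ) *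
        w τ (Sobolev.ofSchwartz (reactionDiffusion d a φ))) volume 0 t)
    (hw : ∀ φ : 𝓢(EuclideanSpace ℝ (Fin N), ℂ), HasCompactSupport φ → VolterraEq α d a T w φ)
    (φ : 𝓢(EuclideanSpace ℝ (Fin N), ℂ)) : VolterraEq α d a T w φ := by
  intro t ht
  obtain ⟨ψ, hψ, hlim⟩ := exists_hasCompactSupport_tendsto φ
  have hA : Tendsto (fun n ↦ Sobolev.ofSchwartz (m := m) (reactionDiffusion d a (ψ n))) atTop
      (𝓝 (Sobolev.ofSchwartz (reactionDiffusion d a φ))) :=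
    ((Sobolev.ofSchwartz.continuous.comp (continuous_reactionDiffusion d a)).tendsto φ).comp hlim
  obtain ⟨C, hC⟩ := hA.norm.bddAbove_range
  have hC' : ∀ n, ‖Sobolev.ofSchwartz (m := m) (reactionDiffusion d a (ψ n))‖ ≤ C :=
    fun n ↦ hC ⟨n, rfl⟩
  have hlhs : Tendsto (fun n ↦ w t (Sobolev.ofSchwartz (ψ n))) atTop
      (𝓝 (w t (Sobolev.ofSchwartz φ))) :=
    (((w t).continuous.comp Sobolev.ofSchwartz.continuous).tendsto φ).comp hlim
  have hrhs : Tendsto (fun n ↦ ∫ τ in (0 : ℝ)..t, (((t - τ) ^ (α - 1) : ℝ) : ℂ) *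
      w τ (Sobolev.ofSchwartz (reactionDiffusion d a (ψ n)))) atTop
      (𝓝 (∫ τ in (0 : ℝ)..t, (((t - τ) ^ (α - 1) : ℝ) : ℂ) *
        w τ (Sobolev.ofSchwartz (reactionDiffusion d a φ)))) := by
    -- The bound is a multiple of `(t - τ)^(α-1) τ^(-α)`, with `-α` written as `(1 - α) - 1` to fit
    -- the Beta integrand. The hypothesis `hint` supplies the measurability in `τ`.
    refine intervalIntegral.tendsto_integral_filter_of_dominated_convergence
      (fun τ ↦ M * C * ((t - τ) ^ (α - 1) * τ ^ ((1 - α) - 1)))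
      (Eventually.of_forall fun n ↦ (hint (ψ n) (hψ n) t ht).def'.aestronglyMeasurable)
      (Eventually.of_forall fun n ↦ Eventually.of_forall fun τ hτ ↦ ?_)
      ((intervalIntegrable_beta hα₀ (by linarith) ht.1).const_mul _)
      (Eventually.of_forall fun τ hτ ↦ ?_)
    · rw [uIoc_of_le ht.1] at hτ
      refine norm_kernel_mul_apply_le hτ.2 ?_
      have h1 := hM τ ⟨hτ.1, hτ.2.trans ht.2⟩
      rw [show 1 - α - 1 = -α by ring]
      calc _ ≤ ‖w τ‖ * ‖Sobolev.ofSchwartz (m := m) (reactionDiffusion d a (ψ n))‖ :=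
            (w τ).le_opNorm _
        _ ≤ (M * τ ^ (-α)) * C :=
          mul_le_mul h1 (hC' n) (norm_nonneg _) ((norm_nonneg _).trans h1)
        _ = _ := by ring
    · exact (((w τ).continuous.tendsto _).comp hA).const_mul _
  refine tendsto_nhds_unique hlhs ((hrhs.const_mul _).congr fun n ↦ ?_)
  exact (hw (ψ n) (hψ n) t ht).symm

/-- Each use of the equation costs a factor `C`, and the Beta integral raises the power of `t` by
`α` while supplying the matching quotient of Gamma values. The induction runs over all `φ` with the
same `R`, since `dΔ + a` does not enlarge the Fourier support. -/
theorem norm_apply_le_of_volterraEq (hα₀ : 0 < α) (hα₁ : α < 1) (hd : 0 ≤ d) (ha : 0 ≤ a)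
    {w : ℝ → NegSobolev N m} {M R : ℝ} (hM₀ : 0 ≤ M) (hM : ∀ t ∈ Ioc 0 T, ‖w t‖ ≤ M * t ^ (-α))
    (hw : ∀ φ, VolterraEq α d a T w φ) (n : ℕ) (φ : 𝓢(EuclideanSpace ℝ (Fin N), ℂ))
    (hφ : ∀ ξ, R < ‖ξ‖ → 𝓕 φ ξ = 0) {t : ℝ} (ht : t ∈ Ioc 0 T) :
    ‖w t (Sobolev.ofSchwartz φ)‖ ≤ M * Real.Gamma (1 - α) *
      (a + 4 * Real.pi ^ 2 * d * R ^ 2) ^ n / Real.Gamma (1 - α + n * α) *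
        ‖Sobolev.ofSchwartz (m := m) φ‖ * t ^ (1 - α + n * α - 1) := by
  have hG₀ : 0 < Real.Gamma (1 - α) := Real.Gamma_pos_of_pos (by linarith)
  have hGα : 0 < Real.Gamma α := Real.Gamma_pos_of_pos hα₀
  set C := a + 4 * Real.pi ^ 2 * d * R ^ 2 with hC
  have hC₀ : 0 ≤ C := by positivity
  induction n generalizing φ t with
  | zero =>
    rw [show 1 - α + ((0 : ℕ) : ℝ) * α - 1 = -α by simp,
      show 1 - α + ((0 : ℕ) : ℝ) * α = 1 - α by simp, pow_zero, mul_one, mul_div_assoc,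
      div_self hG₀.ne', mul_one]
    calc _ ≤ ‖w t‖ * ‖Sobolev.ofSchwartz (m := m) φ‖ := (w t).le_opNorm _
      _ ≤ (M * t ^ (-α)) * ‖Sobolev.ofSchwartz (m := m) φ‖ := by gcongr; exact hM t ht
      _ = _ := by ring
  | succ n ih =>
    have hs : 0 < 1 - α + n * α := by
      have : 0 ≤ n * α := by positivity
      linarith
    have hG : 0 < Real.Gamma (1 - α + n * α) := Real.Gamma_pos_of_pos hs
    have hG' : 0 < Real.Gamma (1 - α + n * α + α) := Real.Gamma_pos_of_pos (by linarith)
    have hAφ : ∀ ξ, R < ‖ξ‖ → 𝓕 (reactionDiffusion d a φ) ξ = 0 := fun ξ hξ ↦ by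
      rw [fourier_reactionDiffusion_apply, hφ ξ hξ, mul_zero]
    set D := M * Real.Gamma (1 - α) * C ^ n / Real.Gamma (1 - α + n * α) with hD
    have hD₀ : 0 ≤ D := by positivity
    have hI := intervalIntegrable_beta hα₀ hs ht.1.le
    have hle := intervalIntegral.norm_integral_le_of_norm_le ht.1.le
      (Eventually.of_forall fun τ (hτ : τ ∈ Ioc 0 t) ↦ norm_kernel_mul_apply_le hτ.2
        (ih (reactionDiffusion d a φ) hAφ ⟨hτ.1, hτ.2.trans ht.2⟩)) (hI.const_mul _)
    rw [intervalIntegral.integral_const_mul, integral_beta hα₀ hs ht.1] at hle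
    have hAn := norm_ofSchwartz_reactionDiffusion_le (m := m) hd ha φ hφ
    have ht' : 0 ≤ t ^ (1 - α + n * α + α - 1) := Real.rpow_nonneg ht.1.le _
    rw [hw φ t (Ioc_subset_Icc_self ht), norm_mul, norm_div, norm_one, Complex.norm_real,
      Real.norm_of_nonneg hGα.le,
      show 1 - α + ((n + 1 : ℕ) : ℝ) * α = 1 - α + n * α + α by push_cast; ring]
    calc _ ≤ 1 / Real.Gamma α * (D * (C * ‖Sobolev.ofSchwartz (m := m) φ‖) *
          (Real.Gamma α * Real.Gamma (1 - α + n * α) / Real.Gamma (1 - α + n * α + α) *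
            t ^ (1 - α + n * α + α - 1))) := by
          refine mul_le_mul_of_nonneg_left (hle.trans ?_) (by positivity)
          gcongr
      _ = _ := by
        rw [hD, pow_succ]
        generalize Real.Gamma (1 - α + n * α) = G at hG ⊢
        generalize Real.Gamma (1 - α + n * α + α) = G' at hG' ⊢
        field_simp

theorem apply_eq_zero_of_volterraEq (hα₀ : 0 < α) (hα₁ : α < 1) (hd : 0 ≤ d) (ha : 0 ≤ a)
    {w : ℝ → NegSobolev N m} {M : ℝ} (hM₀ : 0 ≤ M) (hM : ∀ t ∈ Ioc 0 T, ‖w t‖ ≤ M * t ^ (-α))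
    (hw : ∀ φ, VolterraEq α d a T w φ) (φ : 𝓢(EuclideanSpace ℝ (Fin N), ℂ))
    (hφ : HasCompactSupport (𝓕 φ : 𝓢(EuclideanSpace ℝ (Fin N), ℂ))) {t : ℝ} (ht : t ∈ Icc 0 T) :
    w t (Sobolev.ofSchwartz φ) = 0 := by
  -- At `t = 0` the power bound is unavailable, but the equation itself gives an integral over an
  -- empty interval.
  rcases ht.1.eq_or_lt with h0 | h0
  · rw [hw φ t ht, ← h0]
    simp
  obtain ⟨R, hR⟩ := hφ.isCompact.isBounded.exists_norm_le
  have hφ' : ∀ ξ, R < ‖ξ‖ → 𝓕 φ ξ = 0 := fun ξ hξ ↦ by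
    by_contra h
    exact absurd (hR ξ (subset_tsupport _ h)) (not_le.mpr hξ)
  -- The shift to `n + 1` gives `1 - α + (n + 1)α = 1 + nα`, so the bound is a constant times the
  -- `n`-th term of the series of `E_α(C t^α)`.
  have hle := fun n ↦ norm_apply_le_of_volterraEq hα₀ hα₁ hd ha hM₀ hM hw (n + 1) φ hφ' ⟨h0, ht.2⟩
  set C := a + 4 * Real.pi ^ 2 * d * R ^ 2
  have hlim := ((summable_mittagLeffler hα₀ hα₁ (C * t ^ α)).tendsto_atTop_zero).const_mul
    (M * Real.Gamma (1 - α) * C * ‖Sobolev.ofSchwartz (m := m) φ‖)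
  rw [mul_zero] at hlim
  refine norm_le_zero_iff.mp (ge_of_tendsto' hlim fun n ↦ (hle n).trans_eq ?_)
  rw [show 1 - α + ((n + 1 : ℕ) : ℝ) * α = 1 + n * α by push_cast; ring,
    show 1 + n * α - 1 = α * n by ring, Real.rpow_mul_natCast h0.le, mul_pow]
  ring

/-- Two densities: band-limited functions in the Schwartz space, then Schwartz functions in `H^m`.
-/
theorem eq_zero_of_volterraEq (hα₀ : 0 < α) (hα₁ : α < 1) (hd : 0 ≤ d) (ha : 0 ≤ a)
    {w : ℝ → NegSobolev N m} {M : ℝ} (hM₀ : 0 ≤ M) (hM : ∀ t ∈ Ioc 0 T, ‖w t‖ ≤ M * t ^ (-α))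
    (hw : ∀ φ, VolterraEq α d a T w φ) {t : ℝ} (ht : t ∈ Icc 0 T) : w t = 0 := by
  have hS : ∀ φ, w t (Sobolev.ofSchwartz φ) = 0 := fun φ ↦ by
    obtain ⟨ψ, hψ, hlim⟩ := exists_bandLimited_tendsto φ
    have h : Tendsto (fun n ↦ w t (Sobolev.ofSchwartz (ψ n))) atTop
        (𝓝 (w t (Sobolev.ofSchwartz φ))) :=
      (((w t).continuous.comp Sobolev.ofSchwartz.continuous).tendsto φ).comp hlim
    simp only [apply_eq_zero_of_volterraEq hα₀ hα₁ hd ha hM₀ hM hw _ (hψ _) ht] at h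
    exact tendsto_nhds_unique h tendsto_const_nhds
  exact DFunLike.coe_injective (denseRange_ofSchwartz.equalizer (w t).continuous continuous_const
    (funext hS))

theorem IsSolution.eqOn (hα₀ : 0 < α) (hα₁ : α < 1) (hd : 0 ≤ d) (ha : 0 ≤ a)
    {u v : ℝ → NegSobolev N m} (hu : IsSolution α d a T u) (hv : IsSolution α d a T v) :
    EqOn u v (Icc 0 T) := by
  obtain ⟨M, hM₀, hM⟩ := hu.memLinfWeighted.exists_norm_le
  obtain ⟨M', hM₀', hM'⟩ := hv.memLinfWeighted.exists_norm_le
  have hle : ∀ t ∈ Ioc 0 T, ‖(u - v) t‖ ≤ (M + M') * t ^ (-α) := fun t ht ↦ by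
    rw [add_mul]
    exact (norm_sub_le _ _).trans (add_le_add (hM t ht) (hM' t ht))
  have hw := VolterraEq.of_hasCompactSupport (d := d) (a := a) hα₀ hα₁ hle
    (fun φ hφ t ht ↦ by
      simp only [Pi.sub_apply, sub_apply, mul_sub]
      exact (hu.intervalIntegrable hφ ht).sub (hv.intervalIntegrable hφ ht))
    (fun φ hφ ↦ hu.volterraEq_sub hv hφ)
  exact fun t ht ↦ sub_eq_zero.mp
    (eq_zero_of_volterraEq hα₀ hα₁ hd ha (add_nonneg hM₀ hM₀') hle hw ht)

end Uniqueness

end TimeFractional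

theorem theorem1p1 (N m : ℕ) (hm : (N : ℝ) / 2 < m) (α d a T : ℝ) (hα₀ : 0 < α) (hα₁ : α < 1)
    (hd : 0 < d) (ha : 0 ≤ a) (hT : 0 < T) :
    ∃ u : ℝ → TimeFractional.NegSobolev N m,
      TimeFractional.IsSolution α d a T u ∧
      (∀ v : ℝ → TimeFractional.NegSobolev N m,
        TimeFractional.IsSolution α d a T v → Set.EqOn v u (Set.Icc 0 T)) ∧
      (∀ t ∈ Set.Icc 0 T,
        ∃ h : MemLp (TimeFractional.symbol N α d a t) ∞ volume,
          TimeFractional.NegSobolev.toDistribution (u t) =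
            𝓕⁻ (h.toLp _ : 𝓢'(EuclideanSpace ℝ (Fin N), ℂ))) := by
  obtain ⟨u, hu, hsymb⟩ := TimeFractional.exists_isSolution (T := T) hm hα₀ hα₁ hd.le ha
  refine ⟨u, hu, fun v hv ↦ hv.eqOn hα₀ hα₁ hd.le ha hu, fun t ht ↦ ?_⟩
  have hσ : MemLp (TimeFractional.symbol N α d a t) ∞ volume :=
    memLp_top_of_bound ((TimeFractional.continuous_symbol N hα₀ hα₁ d a).comp
      (Continuous.prodMk_right t)).aestronglyMeasurable _
      (Filter.Eventually.of_forall (TimeFractional.norm_symbol_le hα₀ hα₁ hd.le ha ht))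
  exact ⟨hσ, TimeFractional.NegSobolev.toDistribution_eq_fourierInv hσ (u t) (hsymb t ht)⟩
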